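/- For an $M\times K$ real matrix $\mathbf D$ with columns $\mathbf d_1,\dots,\mathbf d_K$ and an integer $r\ge 1$, let $\delta_r(\mathbf D)$ be the smallest $\delta$ such that $(1-\delta)\|\mathbf x\|_2\le\|\mathbf D\mathbf x\|_2\le(1+\delta)\|\mathbf x\|_2$ for all $\mathbf x\in\mathbb R^K$ with at most $r$ nonzero entries. For constants $B,C$ and an integer $s\ge 1$, consider the three estimates 1. $\left\|\mathbf D\mathbf D^T-\frac KM\mathbf I\right\|_2\le \frac{B\sqrt K}{\sqrt M}$ (operator norm); 2. $|\langle \mathbf d_k,\mathbf d_m\rangle|\le \frac{C\log M}{\sqrt M}$ for all $k\ne m$; 3. $\delta_{2s}(\mathbf D)\le \frac{B\sqrt s\log M}{\sqrt M}$, and let $\mathcal G(B)$ be the class of matrices $\mathbf D\in\mathbb R^{M\times K}$ that satisfy 1, 2, 3 and for which, in addition, $\frac{B\sqrt s\log M}{\sqrt M}<\frac18$. There are absolute constants $B,C>0$ such that the following holds. Let $K=K(M)$ and $s=s(M)$ be integers with $1\le s<M<K$ and $K/M^{3/2}\le\sqrt K/\sqrt M$ for all sufficiently large $M$, and let $\mathbf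 D\in\mathbb R^{M\times K}$ be a random matrix whose columns are independent and uniformly distributed on the unit sphere of $\mathbb R^M$. Then for every $a>0$, \[ \lim_{M\to\infty}M^a\,\mathbb P\{\mathbf D\text{ violates at least one of 1, 2, 3}\}=0 . \] Consequently, if moreover $\frac{B\sqrt s\log M}{\sqrt M}<\frac18$ for all sufficiently large $M$, then for every $a>0$, \[ \lim_{M\to\infty}M^a\,\mathbb P\{\mathbf D\notin\mathcal G(B)\}=0 . \] -/

import Mathlib

open Filter Topology MeasureTheory ProbabilityTheory
open scoped Matrix

/-- The `k`-th column of `D`, as a vector of the Euclidean space `ℝ^M`. -/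
noncomputable def dictColumn {M K : ℕ} (D : Matrix (Fin M) (Fin K) ℝ) (k : Fin K) :
    EuclideanSpace ℝ (Fin M) :=
  WithLp.toLp 2 (D.col k)

/-- The uniform distribution on the unit sphere of `ℝ^M`, as a measure on `ℝ^M`: the surface
measure of the sphere, normalized to total mass one (for `M ≥ 1`). -/
noncomputable def uniformUnitSphere (M : ℕ) : Measure (EuclideanSpace ℝ (Fin M)) :=
  ((volume : Measure (EuclideanSpace ℝ (Fin M))).toSphere Set.univ)⁻¹ •
    (volume : Measure (EuclideanSpace ℝ (Fin M))).toSphere.map Subtype.val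

/-- `D` is a random matrix whose columns are independent and uniformly distributed on the
unit sphere of `ℝ^M`. -/
structure IsUniformDictionary {Ω : Type*} [MeasurableSpace Ω] {M K : ℕ}
    (D : Ω → Matrix (Fin M) (Fin K) ℝ) (P : Measure Ω) : Prop where
  indep : iIndepFun (fun (k : Fin K) (ω : Ω) => dictColumn (D ω) k) P
  law : ∀ k : Fin K, HasLaw (fun ω => dictColumn (D ω) k) (uniformUnitSphere M) P

/-- The `s`-restricted isometry constant of `D`: the smallest `δ` such that
`(1 - δ) ‖x‖ ≤ ‖D x‖ ≤ (1 + δ) ‖x‖` for all `x` with at most `s` nonzero entries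
(for `s ≥ 1` and `K ≥ 1` the infimum is attained). -/
noncomputable def restrictedIsometryConstant {M K : ℕ} (D : Matrix (Fin M) (Fin K) ℝ) (s : ℕ) : ℝ :=
  sInf {δ : ℝ | ∀ x : EuclideanSpace ℝ (Fin K), {k : Fin K | x k ≠ 0}.ncard ≤ s →
    (1 - δ) * ‖x‖ ≤ ‖(WithLp.toLp 2 (D *ᵥ x.ofLp) : EuclideanSpace ℝ (Fin M))‖ ∧
    ‖(WithLp.toLp 2 (D *ᵥ x.ofLp) : EuclideanSpace ℝ (Fin M))‖ ≤ (1 + δ) * ‖x‖}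

/-- The `L²` operator norm of `D Dᵀ - (K / M) I`. -/
noncomputable def frameDeviation {M K : ℕ} (D : Matrix (Fin M) (Fin K) ℝ) : ℝ :=
  ‖Matrix.toEuclideanCLM (𝕜 := ℝ) (n := Fin M)
    (D * Dᵀ - ((K : ℝ) / (M : ℝ)) • (1 : Matrix (Fin M) (Fin M) ℝ))‖

/-- The matrices that satisfy the three estimates: covariance, coherence, restricted isometry. -/
def dictionaryBounds (B C : ℝ) (M K s : ℕ) : Set (Matrix (Fin M) (Fin K) ℝ) :=
  {D | frameDeviation D ≤ B * √(K : ℝ) / √(M : ℝ) ∧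
    (∀ k m : Fin K, k ≠ m →
      |inner ℝ (dictColumn D k) (dictColumn D m)| ≤ C * Real.log M / √(M : ℝ)) ∧
    restrictedIsometryConstant D (2 * s) ≤ B * √(s : ℝ) * Real.log M / √(M : ℝ)}

/-- The class `𝒢(B)` of good dictionaries (`C` is the absolute constant in the coherence bound):
the three estimates hold, and the bound on the restricted isometry constant is below `1 / 8`. -/
def goodDictionaries (B C : ℝ) (M K s : ℕ) : Set (Matrix (Fin M) (Fin K) ℝ) :=
  {D | D ∈ dictionaryBounds B C M K s ∧ B * √(s : ℝ) * Real.log M / √(M : ℝ) < 1 / 8}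

/-! A uniform unit vector `u` in dimension `M` is subgaussian at scale `1/√M`: a cap at height `ε`
has measure at most `exp(-Mε²/4)`, which controls the exponential moments of `⟨x,u⟩` and `⟨x,u⟩²`
(`lintegral_exp_inner`, `lintegral_exp_inner_sq`). Estimates 1 and 3 bound a quadratic form at one
fixed vector, then take a union bound over 1/2-nets of unit balls. A net costs `5^dim` points and a
factor 32 (`norm_le_of_abs_inner_le_on_net`).

For 1, the form at `y` is a sum of independent centred subexponential variables, and a Bernstein
bound beats the `5^M` net points.

For 3, the columns enter `∑ x_k d_k` one at a time. As `‖d_k‖ = 1`, given the previous partial sum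
`Y` only the cross term `2x_k⟨Y,d_k⟩` is random; its Laplace transform is bounded by the exponential
of a multiple of `‖Y‖²`, which merely shifts the parameter `t` (`lintegral_exp_chaos_finset`). The
growth hypothesis amounts to `K ≤ M²`, so the nets over all supports of size `2s` have at most
`exp(6 s log M)` points, few enough for the union bound.

Estimate 2 follows by polarization from the 2-sparse case of the bound behind 3. The total failure
probability is at most `2 exp(-M) + 4 exp(-log² M)`, smaller than any power of `M`. -/

open scoped Pointwise

/-! ### The uniform measure on the sphere: cones, invariance, caps -/

lemma uniformUnitSphere_apply {M : ℕ} [NeZero M] {A : Set (EuclideanSpace ℝ (Fin M))}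
    (hA : MeasurableSet A) :
    uniformUnitSphere M A = (volume (Metric.ball (0 : EuclideanSpace ℝ (Fin M)) 1))⁻¹ *
      volume (Set.Ioo (0 : ℝ) 1 • (A ∩ Metric.sphere 0 1)) := by
  have hM : (M : ENNReal) ≠ 0 := by exact_mod_cast NeZero.ne M
  rw [uniformUnitSphere, Measure.smul_apply, Measure.map_apply measurable_subtype_coe hA,
    Measure.toSphere_apply_univ, Measure.toSphere_apply' _ (measurable_subtype_coe hA),
    Subtype.image_preimage_coe, finrank_euclideanSpace_fin, smul_eq_mul, Set.inter_comm A,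
    ENNReal.mul_inv (Or.inl hM) (Or.inl (ENNReal.natCast_ne_top M))]
  rw [mul_mul_mul_comm, ENNReal.inv_mul_cancel hM (ENNReal.natCast_ne_top M), one_mul]

instance uniformUnitSphere_isProbabilityMeasure {M : ℕ} [NeZero M] :
    IsProbabilityMeasure (uniformUnitSphere M) := by
  constructor
  rw [uniformUnitSphere, Measure.smul_apply, Measure.map_apply measurable_subtype_coe .univ,
    Set.preimage_univ, smul_eq_mul, ENNReal.inv_mul_cancel]
  · exact Measure.measure_univ_ne_zero.2 (Measure.toSphere_ne_zero _)
  · exact measure_ne_top _ _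

lemma ae_norm_eq_one_uniformUnitSphere (M : ℕ) : ∀ᵐ u ∂uniformUnitSphere M, ‖u‖ = 1 := by
  refine Measure.ae_smul_measure ?_ _
  rw [ae_map_iff measurable_subtype_coe.aemeasurable (measurableSet_eq_fun (by fun_prop) (by fun_prop))]
  exact ae_of_all _ fun u => by simp

/-- Both sides are normalized volumes of cones, and a linear isometry preserves volume and commutes
with taking cones. -/
lemma uniformUnitSphere_map_isometry {M : ℕ} [NeZero M]
    (U : EuclideanSpace ℝ (Fin M) ≃ₗᵢ[ℝ] EuclideanSpace ℝ (Fin M)) :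
    (uniformUnitSphere M).map U = uniformUnitSphere M := by
  ext A hA
  rw [Measure.map_apply U.continuous.measurable hA, uniformUnitSphere_apply hA,
    uniformUnitSphere_apply (U.continuous.measurable hA)]
  congr 1
  rw [← U.measurePreserving.measure_preimage_emb U.toHomeomorph.measurableEmbedding
    (Set.Ioo (0 : ℝ) 1 • (A ∩ Metric.sphere 0 1))]
  congr 1
  ext v
  simp only [Set.mem_smul, Set.mem_preimage, Set.mem_inter_iff, mem_sphere_zero_iff_norm]
  constructor
  · rintro ⟨r, hr, u, ⟨h1, h2⟩, rfl⟩
    exact ⟨r, hr, U u, ⟨h1, by simpa using h2⟩, (map_smul U r u).symm⟩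
  · rintro ⟨r, hr, u, ⟨h1, h2⟩, h3⟩
    refine ⟨r, hr, U.symm u, ⟨by simpa using h1, by simpa using h2⟩, U.injective ?_⟩
    simpa using h3

/-- The cone over the cap fits in the ball of radius `√(1 - ε²)` about `ε x`, whose relative volume
is `(1 - ε²)^(M/2)`. -/
lemma uniformUnitSphere_cap_of_sq_le_half {M : ℕ} [NeZero M] {x : EuclideanSpace ℝ (Fin M)}
    (hx : ‖x‖ = 1) {ε : ℝ} (hε : 0 < ε) (hε2 : ε ^ 2 ≤ 1 / 2) :
    uniformUnitSphere M {u | ε ≤ inner ℝ x u} ≤ ENNReal.ofReal (Real.exp (-(M * ε ^ 2 / 2))) := by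
  have hsub : Set.Ioo (0 : ℝ) 1 • ({u | ε ≤ inner ℝ x u} ∩ Metric.sphere 0 1) ⊆
      Metric.closedBall (ε • x) (√(1 - ε ^ 2)) := by
    rintro _ ⟨r, ⟨hr0, hr1⟩, u, ⟨hu, hu1⟩, rfl⟩
    have hu1 : ‖u‖ = 1 := by simpa using hu1
    have hu : ε ≤ inner ℝ x u := hu
    rw [mem_closedBall_iff_norm]
    apply Real.le_sqrt_of_sq_le
    have : ‖r • u - ε • x‖ ^ 2 = r ^ 2 - 2 * r * ε * inner ℝ x u + ε ^ 2 := by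
      rw [norm_sub_sq_real, norm_smul, norm_smul, hu1, hx, inner_smul_left, inner_smul_right,
        real_inner_comm]
      simp [abs_of_pos hε, abs_of_pos hr0]; ring
    simp only
    rw [this]
    -- It remains that `r² - 2rε² + ε² ≤ 1 - ε²`, that is `(1 - r)(1 + r - 2ε²) ≥ 0`; this is where
    -- `ε² ≤ 1/2` enters.
    have h1 : r * ε * ε ≤ r * ε * inner ℝ x u := by gcongr
    nlinarith
  have hb0 : volume (Metric.ball (0 : EuclideanSpace ℝ (Fin M)) 1) ≠ 0 :=
    (Metric.measure_ball_pos _ _ one_pos).ne'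
  have hbt : volume (Metric.ball (0 : EuclideanSpace ℝ (Fin M)) 1) ≠ ⊤ := measure_ball_lt_top.ne
  rw [uniformUnitSphere_apply (measurableSet_le (by fun_prop) (by fun_prop))]
  calc _ ≤ (volume (Metric.ball (0 : EuclideanSpace ℝ (Fin M)) 1))⁻¹ *
        volume (Metric.closedBall (ε • x) (√(1 - ε ^ 2))) := by gcongr
    _ = ENNReal.ofReal (√(1 - ε ^ 2) ^ M) := by
      rw [Measure.addHaar_closedBall _ _ (Real.sqrt_nonneg _), finrank_euclideanSpace_fin,
        mul_comm, mul_assoc, ENNReal.mul_inv_cancel hb0 hbt, mul_one]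
    _ ≤ _ := by
      apply ENNReal.ofReal_le_ofReal
      calc √(1 - ε ^ 2) ^ M ≤ Real.exp (-(ε ^ 2 / 2)) ^ M := by
            gcongr
            rw [Real.sqrt_le_left (Real.exp_pos _).le, ← Real.exp_nat_mul]
            have := Real.add_one_le_exp (-ε ^ 2)
            refine le_trans (by linarith) (this.trans (le_of_eq ?_))
            congr 1; push_cast; ring
        _ = _ := by rw [← Real.exp_nat_mul]; congr 1; ring

/-- Between `1/√2` and `1` the cap at height `1/√2` is used instead, which halves the exponent;
above `1` the cap is null. -/
lemma uniformUnitSphere_cap {M : ℕ} [NeZero M] {x : EuclideanSpace ℝ (Fin M)}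
    (hx : ‖x‖ = 1) {ε : ℝ} (hε : 0 < ε) :
    uniformUnitSphere M {u | ε ≤ inner ℝ x u} ≤ ENNReal.ofReal (Real.exp (-(M * ε ^ 2 / 4))) := by
  rcases le_or_gt (ε ^ 2) (1 / 2) with h | h
  · refine (uniformUnitSphere_cap_of_sq_le_half hx hε h).trans (ENNReal.ofReal_le_ofReal ?_)
    apply Real.exp_le_exp.2
    have : 0 ≤ (M : ℝ) * ε ^ 2 := by positivity
    linarith
  rcases le_or_gt ε 1 with h1 | h1
  · have h2 : √(1 / 2 : ℝ) ≤ ε := (Real.sqrt_le_left hε.le).2 h.le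
    have h3 : √(1 / 2 : ℝ) ^ 2 = 1 / 2 := Real.sq_sqrt (by norm_num)
    refine (measure_mono fun u hu => h2.trans hu).trans
      ((uniformUnitSphere_cap_of_sq_le_half hx (by positivity) h3.le).trans
        (ENNReal.ofReal_le_ofReal ?_))
    apply Real.exp_le_exp.2
    rw [h3]
    have : (M : ℝ) * ε ^ 2 ≤ M * 1 := by gcongr; nlinarith
    linarith
  · have : uniformUnitSphere M {u | ε ≤ inner ℝ x u} = 0 := by
      refine measure_mono_null ?_ (ae_iff.1 (ae_norm_eq_one_uniformUnitSphere M))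
      intro u (hu : ε ≤ inner ℝ x u) (hu1 : ‖u‖ = 1)
      have := real_inner_le_norm x u
      rw [hx, hu1] at this
      linarith
    rw [this]; exact zero_le

lemma uniformUnitSphere_lintegral_isometry {M : ℕ} [NeZero M]
    (U : EuclideanSpace ℝ (Fin M) ≃ₗᵢ[ℝ] EuclideanSpace ℝ (Fin M))
    (f : EuclideanSpace ℝ (Fin M) → ENNReal) :
    ∫⁻ u, f (U u) ∂uniformUnitSphere M = ∫⁻ u, f u ∂uniformUnitSphere M := by
  conv_rhs => rw [← uniformUnitSphere_map_isometry U]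
  exact (U.toHomeomorph.measurableEmbedding.lintegral_map _).symm

lemma uniformUnitSphere_abs_inner {M : ℕ} [NeZero M] {x : EuclideanSpace ℝ (Fin M)}
    (hx : ‖x‖ = 1) {ε : ℝ} (hε : 0 < ε) :
    uniformUnitSphere M {u | ε ≤ |inner ℝ x u|} ≤
      2 * ENNReal.ofReal (Real.exp (-(M * ε ^ 2 / 4))) := by
  have : {u | ε ≤ |inner ℝ x u|} = {u | ε ≤ inner ℝ x u} ∪ {u | ε ≤ inner ℝ (-x) u} := by
    ext u; simp [le_abs]
  rw [this, two_mul]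
  exact (measure_union_le _ _).trans (add_le_add (uniformUnitSphere_cap hx hε)
    (uniformUnitSphere_cap (by simpa using hx) hε))

/-! ### Moments and Laplace transforms of `⟨x,u⟩` and `⟨x,u⟩²` -/

lemma integrable_inner_pow_uniformUnitSphere {M : ℕ} [NeZero M] (x : EuclideanSpace ℝ (Fin M))
    (n : ℕ) : Integrable (fun u => inner ℝ x u ^ n) (uniformUnitSphere M) := by
  refine Integrable.of_bound (C := ‖x‖ ^ n) (by fun_prop) ?_
  filter_upwards [ae_norm_eq_one_uniformUnitSphere M] with u hu
  rw [norm_pow]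
  gcongr
  simpa [hu] using norm_inner_le_norm (𝕜 := ℝ) x u

lemma integral_inner_sq_eq_of_norm_eq {M : ℕ} [NeZero M] {x y : EuclideanSpace ℝ (Fin M)}
    (h : ‖x‖ = ‖y‖) :
    ∫ u, inner ℝ x u ^ 2 ∂uniformUnitSphere M = ∫ u, inner ℝ y u ^ 2 ∂uniformUnitSphere M := by
  let U := Submodule.reflection (ℝ ∙ (x - y))ᗮ
  have hU : U x = y := Submodule.reflection_sub h
  rw [← hU]
  conv_rhs => rw [← uniformUnitSphere_map_isometry U]
  refine Eq.trans ?_ (U.toHomeomorph.measurableEmbedding.integral_map _).symm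
  simp

/-- By invariance `x` may be replaced by `‖x‖ e_i` for each `i`; the `M` equal integrals add up to
`‖x‖²` since `∑ u_i² = 1`. -/
lemma integral_inner_sq_uniformUnitSphere {M : ℕ} [NeZero M] (x : EuclideanSpace ℝ (Fin M)) :
    ∫ u, inner ℝ x u ^ 2 ∂uniformUnitSphere M = ‖x‖ ^ 2 / M := by
  have key : ∀ i : Fin M, ∫ u, inner ℝ x u ^ 2 ∂uniformUnitSphere M =
      ∫ u, (‖x‖ * u i) ^ 2 ∂uniformUnitSphere M := fun i => by
    rw [integral_inner_sq_eq_of_norm_eq (y := EuclideanSpace.single i ‖x‖) (by simp)]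
    simp [EuclideanSpace.inner_single_left]
  have hint : ∀ i : Fin M, Integrable (fun u : EuclideanSpace ℝ (Fin M) => (‖x‖ * u i) ^ 2)
      (uniformUnitSphere M) := fun i => by
    simpa [EuclideanSpace.inner_single_left] using
      integrable_inner_pow_uniformUnitSphere (EuclideanSpace.single i ‖x‖) 2
  have hsum : ∑ i : Fin M, ∫ u, (‖x‖ * u i) ^ 2 ∂uniformUnitSphere M = ‖x‖ ^ 2 := by
    rw [← integral_finsetSum _ fun i _ => hint i]
    have : ∀ᵐ u ∂uniformUnitSphere M, ∑ i : Fin M, (‖x‖ * u i) ^ 2 = ‖x‖ ^ 2 := by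
      filter_upwards [ae_norm_eq_one_uniformUnitSphere M] with u hu
      simp_rw [mul_pow]
      rw [← Finset.mul_sum, ← EuclideanSpace.real_norm_sq_eq, hu]
      simp
    rw [integral_congr_ae this]
    simp
  simp_rw [← key] at hsum
  have hM : (M : ℝ) ≠ 0 := by exact_mod_cast NeZero.ne M
  rw [eq_div_iff hM, ← hsum]
  simp [mul_comm]

/-- Layer cake: the cap bound at `ε² = 8 log t / M` gives the tail `2 t⁻²`, so levels above `1`
contribute at most 2 and levels below at most 1. -/
lemma lintegral_exp_inner_sq_of_norm_eq_one {M : ℕ} [NeZero M] {x : EuclideanSpace ℝ (Fin M)}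
    (hx : ‖x‖ = 1) :
    ∫⁻ u, ENNReal.ofReal (Real.exp (M * inner ℝ x u ^ 2 / 8)) ∂uniformUnitSphere M ≤ 3 := by
  have hM : 0 < (M : ℝ) := by exact_mod_cast NeZero.pos M
  rw [lintegral_eq_lintegral_meas_le _ (ae_of_all _ fun u => (Real.exp_pos _).le)
    (Continuous.aemeasurable (by fun_prop))]
  have h1 : ∀ t ∈ Set.Ioi (1 : ℝ), uniformUnitSphere M
      {u | t ≤ Real.exp (M * inner ℝ x u ^ 2 / 8)} ≤ 2 * ENNReal.ofReal (t ^ (-2 : ℝ)) := by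
    intro t (ht : 1 < t)
    have hl : 0 < Real.log t := Real.log_pos ht
    set ε := √(8 * Real.log t / M) with hε
    have hεp : 0 < ε := Real.sqrt_pos.2 (by positivity)
    have hε2 : ε ^ 2 = 8 * Real.log t / M := Real.sq_sqrt (by positivity)
    refine (measure_mono fun u hu => ?_).trans ((uniformUnitSphere_abs_inner hx hεp).trans_eq ?_)
    · have hu : t ≤ Real.exp (M * inner ℝ x u ^ 2 / 8) := hu
      rw [← Real.log_le_iff_le_exp (by linarith)] at hu
      refine (Real.sqrt_le_left (abs_nonneg _)).2 ?_
      rw [sq_abs, div_le_iff₀ hM]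
      linarith
    · rw [hε2, Real.rpow_def_of_pos (by linarith)]
      congr 3
      field_simp
      norm_num
  calc _ = (∫⁻ t in Set.Ioc (0 : ℝ) 1, uniformUnitSphere M {u | t ≤ Real.exp (M * inner ℝ x u ^ 2 / 8)})
        + ∫⁻ t in Set.Ioi (1 : ℝ), uniformUnitSphere M {u | t ≤ Real.exp (M * inner ℝ x u ^ 2 / 8)} := by
          rw [← lintegral_union measurableSet_Ioi, Set.Ioc_union_Ioi_eq_Ioi zero_le_one]
          exact Set.disjoint_left.2 fun t h1 h2 => not_lt.2 h1.2 h2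
    _ ≤ (∫⁻ t in Set.Ioc (0 : ℝ) 1, 1) + ∫⁻ t in Set.Ioi (1 : ℝ), 2 * ENNReal.ofReal (t ^ (-2 : ℝ)) :=
      add_le_add (lintegral_mono fun _ => prob_le_one) (setLIntegral_mono' measurableSet_Ioi h1)
    _ = 3 := by
      rw [lintegral_const_mul' _ _ (by simp), ← ofReal_integral_eq_lintegral_ofReal
        (integrableOn_Ioi_rpow_of_lt (by norm_num) one_pos), integral_Ioi_rpow_of_lt (by norm_num) one_pos]
      · norm_num
      · filter_upwards [ae_restrict_mem measurableSet_Ioi] with t ht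
        have : (0 : ℝ) < t := lt_trans one_pos ht
        positivity

lemma lintegral_exp_inner_sq {M : ℕ} [NeZero M] {x : EuclideanSpace ℝ (Fin M)}
    (hx : ‖x‖ ≤ 1) :
    ∫⁻ u, ENNReal.ofReal (Real.exp (M * inner ℝ x u ^ 2 / 8)) ∂uniformUnitSphere M ≤ 3 := by
  rcases eq_or_ne x 0 with rfl | h0
  · simp
  have hx0 : 0 < ‖x‖ := norm_pos_iff.2 h0
  refine (lintegral_mono fun u => ?_).trans (lintegral_exp_inner_sq_of_norm_eq_one
    (x := (‖x‖⁻¹) • x) (by rw [norm_smul]; simp [hx0.ne']))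
  apply ENNReal.ofReal_le_ofReal
  have h : |inner ℝ x u| ≤ |inner ℝ (‖x‖⁻¹ • x) u| := by
    rw [inner_smul_left, abs_mul]
    refine le_mul_of_one_le_left (abs_nonneg _) ?_
    simpa using (one_le_inv₀ hx0).2 hx
  have := sq_le_sq.2 h
  gcongr

lemma two_mul_ofReal_cosh (a : ℝ) : 2 * ENNReal.ofReal (Real.cosh a) =
    ENNReal.ofReal (Real.exp a) + ENNReal.ofReal (Real.exp (-a)) := by
  rw [← ENNReal.ofReal_add (Real.exp_pos _).le (Real.exp_pos _).le, Real.cosh_eq,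
    ← ENNReal.ofReal_ofNat 2, ← ENNReal.ofReal_mul zero_le_two]
  congr 1
  ring

/-- For small `t` the constant 3 of the square bound is too large, so the exponential is symmetrized
to `cosh a ≤ exp(a²/2)` and convexity interpolates with weight `θ = 4t²/M`, giving `1 + 2θ`. For
large `t`, `ta ≤ 2t²/M + Ma²/8` suffices and 3 is absorbed in `exp(6t²/M)`. -/
lemma lintegral_exp_inner_of_norm_eq_one {M : ℕ} [NeZero M] {x : EuclideanSpace ℝ (Fin M)}
    (hx : ‖x‖ = 1) (t : ℝ) :
    ∫⁻ u, ENNReal.ofReal (Real.exp (t * inner ℝ x u)) ∂uniformUnitSphere M ≤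
      ENNReal.ofReal (Real.exp (8 * t ^ 2 / M)) := by
  have hM : 0 < (M : ℝ) := by exact_mod_cast NeZero.pos M
  have hsq := lintegral_exp_inner_sq_of_norm_eq_one hx
  rcases le_or_gt (4 * t ^ 2) (M : ℝ) with h | h
  · set θ := 4 * t ^ 2 / M with hθ
    have hθ0 : 0 ≤ θ := by positivity
    have hθ1 : θ ≤ 1 := (div_le_one hM).2 h
    have hcosh : ∫⁻ u, ENNReal.ofReal (Real.exp (t * inner ℝ x u)) ∂uniformUnitSphere M =
        ∫⁻ u, ENNReal.ofReal (Real.cosh (t * inner ℝ x u)) ∂uniformUnitSphere M := by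
      have h1 := uniformUnitSphere_lintegral_isometry (LinearIsometryEquiv.neg ℝ)
        fun u : EuclideanSpace ℝ (Fin M) => ENNReal.ofReal (Real.exp (t * inner ℝ x u))
      have h2 : ∀ u : EuclideanSpace ℝ (Fin M), 2 * ENNReal.ofReal (Real.cosh (t * inner ℝ x u)) =
          ENNReal.ofReal (Real.exp (t * inner ℝ x u)) +
          ENNReal.ofReal (Real.exp (t * inner ℝ x (-u))) := fun u => by
        rw [two_mul_ofReal_cosh, inner_neg_right, mul_neg]
      have h3 : 2 * ∫⁻ u, ENNReal.ofReal (Real.cosh (t * inner ℝ x u)) ∂uniformUnitSphere M =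
          2 * ∫⁻ u, ENNReal.ofReal (Real.exp (t * inner ℝ x u)) ∂uniformUnitSphere M := by
        rw [← lintegral_const_mul' _ _ (by simp)]
        simp_rw [h2]
        rw [lintegral_add_left (by fun_prop), two_mul]
        congr 1
      exact ((ENNReal.mul_right_inj (by simp) (by simp)).1 h3).symm
    rw [hcosh]
    calc _ ≤ ∫⁻ u, (ENNReal.ofReal (1 - θ) + ENNReal.ofReal θ *
          ENNReal.ofReal (Real.exp (M * inner ℝ x u ^ 2 / 8))) ∂uniformUnitSphere M := by
          refine lintegral_mono fun u => ?_
          rw [← ENNReal.ofReal_mul hθ0, ← ENNReal.ofReal_add (by linarith) (by positivity)]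
          apply ENNReal.ofReal_le_ofReal
          refine (Real.cosh_le_exp_half_sq _).trans ?_
          have := convexOn_exp.2 (Set.mem_univ 0) (Set.mem_univ (M * inner ℝ x u ^ 2 / 8))
            (sub_nonneg.2 hθ1) hθ0 (by ring)
          simp only [smul_eq_mul, Real.exp_zero, mul_zero, zero_add, mul_one] at this
          refine le_trans (le_of_eq ?_) this
          rw [hθ]; congr 1; field_simp; ring
      _ ≤ ENNReal.ofReal (1 - θ) + ENNReal.ofReal θ * 3 := by
          rw [lintegral_add_left measurable_const, lintegral_const_mul' _ _ (by simp)]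
          simp only [lintegral_const, measure_univ, mul_one]
          gcongr
      _ ≤ _ := by
          rw [← ENNReal.ofReal_ofNat 3, ← ENNReal.ofReal_mul hθ0,
            ← ENNReal.ofReal_add (by linarith) (by positivity)]
          apply ENNReal.ofReal_le_ofReal
          have := Real.add_one_le_exp (8 * t ^ 2 / M)
          have h2 : 8 * t ^ 2 / M = 2 * θ := by rw [hθ]; ring
          linarith
  · calc _ ≤ ∫⁻ u, ENNReal.ofReal (Real.exp (2 * t ^ 2 / M)) *
          ENNReal.ofReal (Real.exp (M * inner ℝ x u ^ 2 / 8)) ∂uniformUnitSphere M := by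
          refine lintegral_mono fun u => ?_
          rw [← ENNReal.ofReal_mul (Real.exp_pos _).le, ← Real.exp_add]
          apply ENNReal.ofReal_le_ofReal
          apply Real.exp_le_exp.2
          have : 2 * t ^ 2 / M + M * inner ℝ x u ^ 2 / 8 - t * inner ℝ x u =
            (4 * t - M * inner ℝ x u) ^ 2 / (8 * M) := by field_simp; ring
          have : 0 ≤ (4 * t - M * inner ℝ x u) ^ 2 / (8 * M) := by positivity
          linarith
      _ ≤ ENNReal.ofReal (Real.exp (2 * t ^ 2 / M)) * ENNReal.ofReal (Real.exp (6 * t ^ 2 / M)) := by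
          rw [lintegral_const_mul' _ _ (by simp)]
          gcongr
          refine hsq.trans ?_
          rw [← ENNReal.ofReal_ofNat 3]
          apply ENNReal.ofReal_le_ofReal
          have h1 : 3 / 2 ≤ 6 * t ^ 2 / M := by rw [le_div_iff₀ hM]; linarith
          refine le_trans ?_ (Real.exp_le_exp.2 h1)
          have := Real.quadratic_le_exp_of_nonneg (x := 3 / 2) (by norm_num)
          linarith
      _ = _ := by
          rw [← ENNReal.ofReal_mul (Real.exp_pos _).le, ← Real.exp_add]
          congr 2; ring

lemma lintegral_exp_inner {M : ℕ} [NeZero M] (x : EuclideanSpace ℝ (Fin M)) :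
    ∫⁻ u, ENNReal.ofReal (Real.exp (inner ℝ x u)) ∂uniformUnitSphere M ≤
      ENNReal.ofReal (Real.exp (8 * ‖x‖ ^ 2 / M)) := by
  rcases eq_or_ne x 0 with rfl | h0
  · simp
  have hx0 : ‖x‖ ≠ 0 := norm_ne_zero_iff.2 h0
  have := lintegral_exp_inner_of_norm_eq_one (x := (‖x‖⁻¹) • x)
    (by rw [norm_smul]; simp [hx0]) ‖x‖
  simpa [inner_smul_left, hx0] using this

/-! ### Concentration of `‖∑ x_k d_k‖²` -/

lemma lintegral_exp_norm_add_smul_sq {Ω : Type*} [MeasurableSpace Ω] {P : Measure Ω}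
    [IsProbabilityMeasure P] {M : ℕ} [NeZero M] {Y d : Ω → EuclideanSpace ℝ (Fin M)}
    (hY : Measurable Y) (hd : Measurable d) (hind : IndepFun Y d P)
    (hlaw : P.map d = uniformUnitSphere M) (x S t : ℝ) :
    ∫⁻ ω, ENNReal.ofReal (Real.exp (t * (‖Y ω + x • d ω‖ ^ 2 - (S + x ^ 2)))) ∂P ≤
      ∫⁻ ω, ENNReal.ofReal
        (Real.exp (t * (‖Y ω‖ ^ 2 - S) + 32 * t ^ 2 * x ^ 2 / M * ‖Y ω‖ ^ 2)) ∂P := by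
  have : IsProbabilityMeasure (P.map Y) := Measure.isProbabilityMeasure_map hY.aemeasurable
  calc _ = ∫⁻ p : EuclideanSpace ℝ (Fin M) × EuclideanSpace ℝ (Fin M),
        ENNReal.ofReal (Real.exp (t * (‖p.1 + x • p.2‖ ^ 2 - (S + x ^ 2))))
          ∂(P.map fun ω => (Y ω, d ω)) := by
        rw [lintegral_map (by fun_prop) (by fun_prop)]
    _ = ∫⁻ y, ∫⁻ u, ENNReal.ofReal (Real.exp (t * (‖y + x • u‖ ^ 2 - (S + x ^ 2))))
          ∂uniformUnitSphere M ∂(P.map Y) := by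
        rw [(indepFun_iff_map_prod_eq_prod_map_map hY.aemeasurable hd.aemeasurable).1 hind, hlaw,
          lintegral_prod _ (by fun_prop)]
    _ ≤ ∫⁻ y, ENNReal.ofReal
        (Real.exp (t * (‖y‖ ^ 2 - S) + 32 * t ^ 2 * x ^ 2 / M * ‖y‖ ^ 2)) ∂(P.map Y) := by
        refine lintegral_mono fun y => ?_
        calc _ = ∫⁻ u, ENNReal.ofReal (Real.exp (t * (‖y‖ ^ 2 - S))) *
              ENNReal.ofReal (Real.exp (inner ℝ ((2 * t * x) • y) u)) ∂uniformUnitSphere M := by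
              refine lintegral_congr_ae ?_
              filter_upwards [ae_norm_eq_one_uniformUnitSphere M] with u hu
              rw [← ENNReal.ofReal_mul (Real.exp_pos _).le, ← Real.exp_add, norm_add_sq_real,
                norm_smul, hu, inner_smul_left, inner_smul_right]
              congr 2
              simp only [Real.norm_eq_abs, mul_one, sq_abs, conj_trivial]
              ring
          _ ≤ ENNReal.ofReal (Real.exp (t * (‖y‖ ^ 2 - S))) *
              ENNReal.ofReal (Real.exp (8 * ‖(2 * t * x) • y‖ ^ 2 / M)) := by
              rw [lintegral_const_mul' _ _ (by simp)]
              gcongr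
              exact lintegral_exp_inner _
          _ = _ := by
              rw [← ENNReal.ofReal_mul (Real.exp_pos _).le, ← Real.exp_add, norm_smul, mul_pow,
                Real.norm_eq_abs, sq_abs]
              congr 2
              ring
    _ = _ := by rw [lintegral_map (by fun_prop) hY]

/-- With `t = (m/512) a` the shift reads `a ↦ a + a²q/16`. Since `|a| ≤ 2` it costs at most `q/4`,
less than the room `q` gained in the range `2 - S` by dropping one column. -/
lemma chaos_exponent_step {m S q t : ℝ} (hm : 0 < m) (hS : 0 ≤ S) (hS1 : S + q ≤ 1) (hq : 0 ≤ q)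
    (ht : |t| ≤ m / 512 * (2 - (q + S))) :
    |t + 32 * t ^ 2 * q / m| ≤ m / 512 * (2 - S) ∧
    64 * (t + 32 * t ^ 2 * q / m) ^ 2 * S / m + 32 * t ^ 2 * q / m * S ≤
      64 * t ^ 2 * (q + S) / m := by
  obtain ⟨a, rfl⟩ : ∃ a, t = m / 512 * a := ⟨512 * t / m, by field_simp⟩
  rw [abs_mul, abs_of_pos (by positivity : 0 < m / 512)] at ht
  have ha : |a| ≤ 2 - (q + S) := le_of_mul_le_mul_left ht (by positivity)
  have ha2 := abs_le.1 ha
  have e1 : m / 512 * a + 32 * (m / 512 * a) ^ 2 * q / m = m / 512 * (a + a ^ 2 * q / 16) := by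
    field_simp; ring
  have hasq : a ^ 2 ≤ 4 := by
    rw [← sq_abs]; nlinarith [abs_nonneg a]
  have haq : a ^ 2 * q ≤ 4 * q := by gcongr
  have haq0 : 0 ≤ a ^ 2 * q := by positivity
  constructor
  · rw [e1, abs_mul, abs_of_pos (by positivity : 0 < m / 512)]
    gcongr
    rw [abs_le]
    constructor <;> nlinarith
  · rw [e1]
    have e2 : 64 * (m / 512 * a) ^ 2 * (q + S) / m -
      (64 * (m / 512 * (a + a ^ 2 * q / 16)) ^ 2 * S / m + 32 * (m / 512 * a) ^ 2 * q / m * S) =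
      (m / 4096) * (a ^ 2 * q) * (1 - a * S / 8 - a ^ 2 * q * S / 256 - S / 2) := by
      field_simp; ring
    -- With `S ≤ 1`, the bracket is at least `1 - 1/4 - 1/64 - 1/2 > 0`.
    have h1 : a * S ≤ 2 := by nlinarith
    have h2 : a ^ 2 * q * S ≤ 4 := by nlinarith
    have : 0 ≤ (m / 4096) * (a ^ 2 * q) * (1 - a * S / 8 - a ^ 2 * q * S / 256 - S / 2) := by
      apply mul_nonneg (by positivity)
      linarith
    linarith

/-- Integrating out one column replaces `t` by a shifted parameter, so the induction runs over all
`t` in a range that widens as columns are removed. -/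
lemma lintegral_exp_chaos_finset {Ω ι : Type*} [MeasurableSpace Ω] {P : Measure Ω}
    [IsProbabilityMeasure P] {M : ℕ} [NeZero M] {d : ι → Ω → EuclideanSpace ℝ (Fin M)}
    (hd : ∀ k, Measurable (d k)) (hind : iIndepFun d P)
    (hlaw : ∀ k, P.map (d k) = uniformUnitSphere M) (x : ι → ℝ) (T : Finset ι)
    (hx : ∑ k ∈ T, x k ^ 2 ≤ 1) {t : ℝ} (ht : |t| ≤ M / 512 * (2 - ∑ k ∈ T, x k ^ 2)) :
    ∫⁻ ω, ENNReal.ofReal (Real.exp (t * (‖∑ k ∈ T, x k • d k ω‖ ^ 2 - ∑ k ∈ T, x k ^ 2))) ∂P ≤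
      ENNReal.ofReal (Real.exp (64 * t ^ 2 * (∑ k ∈ T, x k ^ 2) / M)) := by
  classical
  have hM : 0 < (M : ℝ) := by exact_mod_cast NeZero.pos M
  induction T using Finset.induction_on generalizing t with
  | empty => simp
  | insert i T hi ih =>
    rw [Finset.sum_insert hi] at hx ht ⊢
    set S := ∑ k ∈ T, x k ^ 2 with hS
    have hS0 : 0 ≤ S := Finset.sum_nonneg fun _ _ => sq_nonneg _
    obtain ⟨h1, h2⟩ := chaos_exponent_step hM hS0 (by linarith) (sq_nonneg (x i)) ht
    have hind' : IndepFun (fun ω => ∑ k ∈ T, x k • d k ω) (d i) P := by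
      have hψ : Measurable fun v : ({i} : Finset ι) → EuclideanSpace ℝ (Fin M) =>
        v ⟨i, Finset.mem_singleton_self i⟩ := measurable_pi_apply _
      have h := (hind.indepFun_finset T {i} (by simpa using hi) hd).comp
        (φ := fun v => ∑ k : T, x k • v k) (by fun_prop) hψ
      have e : (fun ω => ∑ k ∈ T, x k • d k ω) =
          (fun v : T → EuclideanSpace ℝ (Fin M) => ∑ k : T, x k • v k) ∘
            fun ω (k : T) => d k ω := by
        ext1 ω
        exact (Finset.sum_coe_sort T fun k => x k • d k ω).symm
      rw [e]
      exact h
    have h3 := lintegral_exp_norm_add_smul_sq (Y := fun ω => ∑ k ∈ T, x k • d k ω)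
      (Finset.measurable_sum T fun k _ => (hd k).const_smul (x k)) (hd i) hind'
      (hlaw i) (x i) S t
    calc _ = _ := by
          simp_rw [Finset.sum_insert hi, add_comm (x i ^ 2), add_comm (x i • d i _)]
      _ ≤ _ := h3
      -- Writing `‖Y‖² = (‖Y‖² - S) + S` moves the new multiple of `‖Y‖²` into the parameter, up to
      -- a deterministic factor.
      _ = ∫⁻ ω, ENNReal.ofReal (Real.exp (32 * t ^ 2 * x i ^ 2 / M * S)) *
            ENNReal.ofReal (Real.exp ((t + 32 * t ^ 2 * x i ^ 2 / M) *
              (‖∑ k ∈ T, x k • d k ω‖ ^ 2 - S))) ∂P := by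
          refine lintegral_congr fun ω => ?_
          rw [← ENNReal.ofReal_mul (Real.exp_pos _).le, ← Real.exp_add]
          congr 2
          ring
      _ ≤ ENNReal.ofReal (Real.exp (32 * t ^ 2 * x i ^ 2 / M * S)) * ENNReal.ofReal
            (Real.exp (64 * (t + 32 * t ^ 2 * x i ^ 2 / M) ^ 2 * S / M)) := by
          rw [lintegral_const_mul' _ _ (by simp)]
          gcongr
          exact ih (by nlinarith [sq_nonneg (x i)]) h1
      _ ≤ _ := by
          rw [← ENNReal.ofReal_mul (Real.exp_pos _).le, ← Real.exp_add]
          apply ENNReal.ofReal_le_ofReal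
          apply Real.exp_le_exp.2
          linarith

lemma measure_le_abs_of_lintegral_exp_le {Ω : Type*} [MeasurableSpace Ω] {P : Measure Ω}
    {W : Ω → ℝ} (hW : Measurable W) {t c : ℝ} (ht : 0 ≤ t)
    (h1 : ∫⁻ ω, ENNReal.ofReal (Real.exp (t * W ω)) ∂P ≤ ENNReal.ofReal (Real.exp c))
    (h2 : ∫⁻ ω, ENNReal.ofReal (Real.exp (-t * W ω)) ∂P ≤ ENNReal.ofReal (Real.exp c)) (ρ : ℝ) :
    P {ω | ρ ≤ |W ω|} ≤ 2 * ENNReal.ofReal (Real.exp (c - t * ρ)) := by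
  have key : ∀ V : Ω → ℝ, Measurable V →
      ∫⁻ ω, ENNReal.ofReal (Real.exp (t * V ω)) ∂P ≤ ENNReal.ofReal (Real.exp c) →
      P {ω | ρ ≤ V ω} ≤ ENNReal.ofReal (Real.exp (c - t * ρ)) := by
    intro V hV h
    have h0 : ENNReal.ofReal (Real.exp (t * ρ)) ≠ 0 := by simp [Real.exp_pos]
    calc P {ω | ρ ≤ V ω} ≤ P {ω | ENNReal.ofReal (Real.exp (t * ρ)) ≤
          ENNReal.ofReal (Real.exp (t * V ω))} := by
          refine measure_mono fun ω (hω : ρ ≤ V ω) => ?_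
          exact ENNReal.ofReal_le_ofReal (Real.exp_le_exp.2 (by gcongr))
      _ ≤ (∫⁻ ω, ENNReal.ofReal (Real.exp (t * V ω)) ∂P) / ENNReal.ofReal (Real.exp (t * ρ)) :=
          meas_ge_le_lintegral_div (by fun_prop) h0 (by simp)
      _ ≤ ENNReal.ofReal (Real.exp c) / ENNReal.ofReal (Real.exp (t * ρ)) := by gcongr
      _ = _ := by rw [← ENNReal.ofReal_div_of_pos (Real.exp_pos _), ← Real.exp_sub]
  have : {ω | ρ ≤ |W ω|} = {ω | ρ ≤ W ω} ∪ {ω | ρ ≤ -W ω} := by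
    ext ω; simp [le_abs]
  rw [this, two_mul]
  refine (measure_union_le _ _).trans (add_le_add (key W hW h1) (key _ hW.neg ?_))
  simpa using h2

lemma measure_le_abs_chaos {Ω ι : Type*} [MeasurableSpace Ω] {P : Measure Ω}
    [IsProbabilityMeasure P] [Fintype ι] {M : ℕ} [NeZero M]
    {d : ι → Ω → EuclideanSpace ℝ (Fin M)}
    (hd : ∀ k, Measurable (d k)) (hind : iIndepFun d P)
    (hlaw : ∀ k, P.map (d k) = uniformUnitSphere M) {x : EuclideanSpace ℝ ι}
    (hx : ‖x‖ ≤ 1) {t : ℝ} (ht0 : 0 ≤ t) (ht : t ≤ M / 512) (ρ : ℝ) :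
    P {ω | ρ ≤ |‖∑ k, x k • d k ω‖ ^ 2 - ‖x‖ ^ 2|} ≤
      2 * ENNReal.ofReal (Real.exp (64 * t ^ 2 / M - t * ρ)) := by
  have hM : 0 < (M : ℝ) := by exact_mod_cast NeZero.pos M
  have hx2 : ‖x‖ ^ 2 ≤ 1 := pow_le_one₀ (norm_nonneg _) hx
  have key : ∀ t : ℝ, |t| ≤ M / 512 →
      ∫⁻ ω, ENNReal.ofReal (Real.exp (t * (‖∑ k, x k • d k ω‖ ^ 2 - ‖x‖ ^ 2))) ∂P ≤
        ENNReal.ofReal (Real.exp (64 * t ^ 2 / M)) := by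
    intro t ht
    rw [EuclideanSpace.real_norm_sq_eq] at hx2 ⊢
    refine (lintegral_exp_chaos_finset hd hind hlaw x Finset.univ hx2 (ht.trans ?_)).trans ?_
    · refine le_mul_of_one_le_right (by positivity) (by linarith)
    · apply ENNReal.ofReal_le_ofReal
      apply Real.exp_le_exp.2
      refine div_le_div_of_nonneg_right ?_ hM.le
      exact mul_le_of_le_one_right (by positivity) hx2
  refine measure_le_abs_of_lintegral_exp_le (by fun_prop) ht0
    (key t (by rwa [abs_of_nonneg ht0])) ?_ ρ
  simpa using key (-t) (by rwa [abs_neg, abs_of_nonneg ht0])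

/-! ### Bernstein bound for `∑ (⟨x,d_k⟩² - ‖x‖²/M)` -/

/-- Second-order Taylor remainder: one factor `exp(|X|/2)` bounds `exp |sX|`, the other absorbs
`X²`. -/
lemma exp_mul_le_of_abs_le_half {s : ℝ} (hs : |s| ≤ 1 / 2) (X : ℝ) :
    Real.exp (s * X) ≤ 1 + s * X + 8 * s ^ 2 * Real.exp |X| := by
  have h1 : |Real.exp (s * X) - (1 + s * X)| ≤ |s * X| ^ 2 * Real.exp |s * X| := by
    have := Complex.norm_exp_sub_sum_le_norm_mul_exp ((s * X : ℝ) : ℂ) 2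
    rw [← Complex.ofReal_exp] at this
    simp only [Finset.sum_range_succ, Finset.sum_range_zero] at this
    norm_num at this
    norm_cast at this
    simpa using this
  have h2 : |s * X| ≤ |X| / 2 := by
    rw [abs_mul]
    nlinarith [abs_nonneg X]
  have h3 : X ^ 2 ≤ 8 * Real.exp (|X| / 2) := by
    have := Real.quadratic_le_exp_of_nonneg (x := |X| / 2) (by positivity)
    have h4 := sq_abs X
    nlinarith [abs_nonneg X]
  have h5 : |s * X| ^ 2 * Real.exp |s * X| ≤ 8 * s ^ 2 * Real.exp |X| := by
    calc |s * X| ^ 2 * Real.exp |s * X| ≤ |s * X| ^ 2 * Real.exp (|X| / 2) := by gcongr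
      _ = s ^ 2 * X ^ 2 * Real.exp (|X| / 2) := by rw [sq_abs]; ring
      _ ≤ s ^ 2 * (8 * Real.exp (|X| / 2)) * Real.exp (|X| / 2) := by gcongr
      _ = 8 * s ^ 2 * (Real.exp (|X| / 2) * Real.exp (|X| / 2)) := by ring
      _ = _ := by rw [← Real.exp_add]; ring_nf
  linarith [le_abs_self (Real.exp (s * X) - (1 + s * X))]

lemma lintegral_exp_mul_le_of_lintegral_exp_abs_le {Ω : Type*} [MeasurableSpace Ω]
    {P : Measure Ω} [IsProbabilityMeasure P] {X : Ω → ℝ} (hX : Measurable X)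
    (hint : Integrable X P) (hmean : ∫ ω, X ω ∂P = 0)
    (hexp : ∫⁻ ω, ENNReal.ofReal (Real.exp |X ω|) ∂P ≤ 4) {s : ℝ} (hs : |s| ≤ 1 / 2) :
    ∫⁻ ω, ENNReal.ofReal (Real.exp (s * X ω)) ∂P ≤ ENNReal.ofReal (Real.exp (32 * s ^ 2)) := by
  have hie : Integrable (fun ω => Real.exp |X ω|) P := by
    refine (lintegral_ofReal_ne_top_iff_integrable (by fun_prop)
      (ae_of_all _ fun _ => (Real.exp_pos _).le)).1 (ne_top_of_le_ne_top (by simp) hexp)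
  have hI : ∫ ω, Real.exp |X ω| ∂P ≤ 4 := by
    rw [integral_eq_lintegral_of_nonneg_ae (ae_of_all _ fun _ => (Real.exp_pos _).le)
      hie.aestronglyMeasurable]
    exact ENNReal.toReal_le_of_le_ofReal (by norm_num) (by simpa using hexp)
  have hi1 : Integrable (fun ω => 1 + s * X ω) P := (integrable_const 1).add (hint.const_mul s)
  have hi2 : Integrable (fun ω => 8 * s ^ 2 * Real.exp |X ω|) P := hie.const_mul _
  calc _ ≤ ∫⁻ ω, ENNReal.ofReal (1 + s * X ω + 8 * s ^ 2 * Real.exp |X ω|) ∂P :=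
        lintegral_mono fun ω => ENNReal.ofReal_le_ofReal (exp_mul_le_of_abs_le_half hs _)
    _ = ENNReal.ofReal (∫ ω, (1 + s * X ω + 8 * s ^ 2 * Real.exp |X ω|) ∂P) := by
        refine (ofReal_integral_eq_lintegral_ofReal (hi1.add hi2) ?_).symm
        exact ae_of_all _ fun ω => (Real.exp_pos _).le.trans (exp_mul_le_of_abs_le_half hs (X ω))
    _ ≤ _ := by
        apply ENNReal.ofReal_le_ofReal
        rw [integral_add hi1 hi2,
          integral_add (integrable_const 1) (hint.const_mul s), integral_const_mul,
          integral_const_mul, hmean]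
        have := Real.add_one_le_exp (32 * s ^ 2)
        have h2 : 8 * s ^ 2 * ∫ ω, Real.exp |X ω| ∂P ≤ 8 * s ^ 2 * 4 := by gcongr
        simp
        linarith

lemma lintegral_exp_inner_sq_sub {M : ℕ} [NeZero M] {x : EuclideanSpace ℝ (Fin M)}
    (hx : ‖x‖ ≤ 1) {t : ℝ} (ht : |t| ≤ M / 16) :
    ∫⁻ u, ENNReal.ofReal (Real.exp (t * (inner ℝ x u ^ 2 - ‖x‖ ^ 2 / M))) ∂uniformUnitSphere M ≤
      ENNReal.ofReal (Real.exp (2048 * t ^ 2 / M ^ 2)) := by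
  have hM : 0 < (M : ℝ) := by exact_mod_cast NeZero.pos M
  have hi := integrable_inner_pow_uniformUnitSphere x 2
  have hs : |8 * t / M| ≤ 1 / 2 := by
    rw [abs_div, abs_mul, abs_of_pos hM, div_le_iff₀ hM]
    norm_num
    linarith
  -- The scale `M/8` makes `|X| ≤ 1/8 + M⟨x,u⟩²/8`, whence `E exp |X| ≤ 3 exp(1/8) ≤ 4`.
  have h := lintegral_exp_mul_le_of_lintegral_exp_abs_le (P := uniformUnitSphere M)
    (X := fun u => M / 8 * (inner ℝ x u ^ 2 - ‖x‖ ^ 2 / M)) (by fun_prop)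
    ((hi.sub (integrable_const _)).const_mul _) ?_ ?_ hs
  · have e1 : ∀ a : ℝ, 8 * t / M * (M / 8 * a) = t * a := fun a => by field_simp
    have e2 : 32 * (8 * t / M) ^ 2 = 2048 * t ^ 2 / M ^ 2 := by ring
    simpa only [e1, e2] using h
  · rw [integral_const_mul, integral_sub hi (integrable_const _),
      integral_inner_sq_uniformUnitSphere]
    simp
  · calc _ ≤ ∫⁻ u, ENNReal.ofReal (Real.exp (1 / 8)) *
          ENNReal.ofReal (Real.exp (M * inner ℝ x u ^ 2 / 8)) ∂uniformUnitSphere M := by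
          refine lintegral_mono fun u => ?_
          rw [← ENNReal.ofReal_mul (Real.exp_pos _).le, ← Real.exp_add]
          apply ENNReal.ofReal_le_ofReal
          apply Real.exp_le_exp.2
          have e : M / 8 * (inner ℝ x u ^ 2 - ‖x‖ ^ 2 / M) =
            M * inner ℝ x u ^ 2 / 8 - ‖x‖ ^ 2 / 8 := by field_simp
          have h1 : ‖x‖ ^ 2 ≤ 1 := pow_le_one₀ (norm_nonneg _) hx
          have h2 : 0 ≤ M * inner ℝ x u ^ 2 := by positivity
          have h3 := sq_nonneg ‖x‖
          rw [e, abs_le]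
          constructor <;> linarith
      _ ≤ ENNReal.ofReal (Real.exp (1 / 8)) * 3 := by
          rw [lintegral_const_mul' _ _ (by simp)]
          gcongr
          exact lintegral_exp_inner_sq hx
      _ ≤ ENNReal.ofReal (4 / 3) * 3 := by
          gcongr
          have := Real.abs_exp_sub_one_sub_id_le (x := 1 / 8) (by norm_num [abs_of_pos])
          rw [abs_le] at this
          linarith
      _ = 4 := by
          rw [← ENNReal.ofReal_ofNat 3, ← ENNReal.ofReal_mul (by norm_num)]
          norm_num

lemma measure_le_abs_sum_inner_sq {Ω ι : Type*} [MeasurableSpace Ω] {P : Measure Ω}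
    [Fintype ι] {M : ℕ} [NeZero M] {d : ι → Ω → EuclideanSpace ℝ (Fin M)}
    (hd : ∀ k, Measurable (d k)) (hind : iIndepFun d P)
    (hlaw : ∀ k, P.map (d k) = uniformUnitSphere M) {x : EuclideanSpace ℝ (Fin M)}
    (hx : ‖x‖ ≤ 1) {t : ℝ} (ht0 : 0 ≤ t) (ht : t ≤ M / 16) (ρ : ℝ) :
    P {ω | ρ ≤ |∑ k, (inner ℝ x (d k ω) ^ 2 - ‖x‖ ^ 2 / M)|} ≤
      2 * ENNReal.ofReal (Real.exp (Fintype.card ι * (2048 * t ^ 2 / M ^ 2) - t * ρ)) := by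
  have key : ∀ t : ℝ, |t| ≤ M / 16 →
      ∫⁻ ω, ENNReal.ofReal
          (Real.exp (t * ∑ k, (inner ℝ x (d k ω) ^ 2 - ‖x‖ ^ 2 / M))) ∂P ≤
        ENNReal.ofReal (Real.exp (Fintype.card ι * (2048 * t ^ 2 / M ^ 2))) := by
    intro t ht
    have hmeas : Measurable fun u : EuclideanSpace ℝ (Fin M) =>
      ENNReal.ofReal (Real.exp (t * (inner ℝ x u ^ 2 - ‖x‖ ^ 2 / M))) := by fun_prop
    simp_rw [Finset.mul_sum, Real.exp_sum,
      ENNReal.ofReal_prod_of_nonneg fun _ _ => (Real.exp_pos _).le]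
    rw [lintegral_prod_eq_prod_lintegral_of_indepFun Finset.univ
      (fun k ω => ENNReal.ofReal (Real.exp (t * (inner ℝ x (d k ω) ^ 2 - ‖x‖ ^ 2 / M))))
      (hind.comp (fun _ u => ENNReal.ofReal (Real.exp (t * (inner ℝ x u ^ 2 - ‖x‖ ^ 2 / M))))
        fun _ => hmeas) fun k => hmeas.comp (hd k)]
    calc _ ≤ ∏ _k : ι, ENNReal.ofReal (Real.exp (2048 * t ^ 2 / M ^ 2)) := by
          refine Finset.prod_le_prod' fun k _ => ?_
          rw [← lintegral_map hmeas (hd k), hlaw k]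
          exact lintegral_exp_inner_sq_sub hx ht
      _ = _ := by
          rw [Finset.prod_const, ← ENNReal.ofReal_pow (Real.exp_pos _).le, ← Real.exp_nat_mul,
            Finset.card_univ]
  refine measure_le_abs_of_lintegral_exp_le (by fun_prop) ht0
    (key t (by rwa [abs_of_nonneg ht0])) ?_ ρ
  simpa using key (-t) (by rwa [abs_neg, abs_of_nonneg ht0])

/-! ### Nets and quadratic forms -/

/-- A 1-separated subset of the ball of radius 2 of maximal size is a 1-net there; halving it gives
the net, and Besicovitch's packing bound counts it. -/
lemma exists_half_net_unitBall (E : Type*) [NormedAddCommGroup E] [NormedSpace ℝ E]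
    [FiniteDimensional ℝ E] :
    ∃ N : Finset E, N.card ≤ 5 ^ Module.finrank ℝ E ∧ (∀ y ∈ N, ‖y‖ ≤ 1) ∧
      ∀ x : E, ‖x‖ ≤ 1 → ∃ y ∈ N, ‖x - y‖ ≤ 1 / 2 := by
  classical
  let S : Set ℕ := {n | ∃ s : Finset E, s.card = n ∧ (∀ c ∈ s, ‖c‖ ≤ 2) ∧
    ∀ c ∈ s, ∀ d ∈ s, c ≠ d → 1 ≤ ‖c - d‖}
  have hS : BddAbove S := by
    refine ⟨5 ^ Module.finrank ℝ E, ?_⟩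
    rintro _ ⟨s, rfl, h1, h2⟩
    exact Besicovitch.card_le_of_separated s h1 h2
  obtain ⟨s, hcard, h1, h2⟩ : sSup S ∈ S := Nat.sSup_mem ⟨0, ∅, by simp⟩ hS
  refine ⟨s.image fun c => (1 / 2 : ℝ) • c,
    Finset.card_image_le.trans (Besicovitch.card_le_of_separated s h1 h2), ?_, fun x hx => ?_⟩
  · intro y hy
    obtain ⟨c, hc, rfl⟩ := Finset.mem_image.1 hy
    rw [norm_smul]
    norm_num
    linarith [h1 c hc]
  · have hx2 : ‖(2 : ℝ) • x‖ ≤ 2 := by rw [norm_smul]; norm_num; linarith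
    obtain ⟨c, hc, hxc⟩ : ∃ c ∈ s, ‖(2 : ℝ) • x - c‖ ≤ 1 := by
      by_contra! hcon
      have hnot : (2 : ℝ) • x ∉ s := fun h => by
        have := hcon _ h
        simp at this
        linarith
      have : (insert ((2 : ℝ) • x) s).card ∈ S := by
        refine ⟨_, rfl, ?_, ?_⟩
        · simpa [hx2] using h1
        · intro c hc d hd hne
          rcases Finset.mem_insert.1 hc with rfl | hc <;> rcases Finset.mem_insert.1 hd with rfl | hd
          · exact absurd rfl hne
          · exact (hcon d hd).le
          · rw [norm_sub_rev]; exact (hcon c hc).le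
          · exact h2 c hc d hd hne
      have := le_csSup hS this
      rw [Finset.card_insert_of_notMem hnot] at this
      omega
    refine ⟨_, Finset.mem_image_of_mem _ hc, ?_⟩
    have : x - (1 / 2 : ℝ) • c = (1 / 2 : ℝ) • ((2 : ℝ) • x - c) := by
      rw [smul_sub, smul_smul]; norm_num
    rw [this, norm_smul]
    norm_num
    linarith

/-- The difference of the form at `x` and `y` is `⟨A(x-y), x+y⟩`. The triangle inequality would only
give `‖x-y‖‖x+y‖ ≤ 1`, which is useless; the parallelogram law gives `√(15/16) < 31/32`, leaving
`‖A‖/32 ≤ ρ`. -/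
lemma norm_le_of_abs_inner_le_on_net {E : Type*} [NormedAddCommGroup E] [InnerProductSpace ℝ E]
    {A : E →L[ℝ] E} (hA : A.IsSymmetric) {N : Finset E} (hN1 : ∀ y ∈ N, ‖y‖ ≤ 1)
    (hN : ∀ x : E, ‖x‖ ≤ 1 → ∃ y ∈ N, ‖x - y‖ ≤ 1 / 2) {ρ : ℝ}
    (hρ : ∀ y ∈ N, |inner ℝ (A y) y| ≤ ρ) : ‖A‖ ≤ 32 * ρ := by
  have hsymm : ∀ x y, inner ℝ (A x) y = inner ℝ x (A y) := hA
  have key : ∀ x : E, ‖x‖ = 1 → |inner ℝ (A x) x| ≤ ρ + ‖A‖ * (31 / 32) := by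
    intro x hx
    obtain ⟨y, hy, hxy⟩ := hN x hx.le
    have h1 : inner ℝ (A x) x - inner ℝ (A y) y = inner ℝ (A (x - y)) (x + y) := by
      rw [map_sub, inner_sub_left, inner_add_right, inner_add_right, hsymm x y,
        real_inner_comm (A y) x]
      ring
    have h2 : ‖x - y‖ * ‖x + y‖ ≤ 31 / 32 := by
      have hp := parallelogram_law_with_norm ℝ x y
      have h3 := hN1 y hy
      have h4 : ‖x + y‖ ^ 2 ≤ 4 - ‖x - y‖ ^ 2 := by nlinarith [norm_nonneg y]
      have h5 : ‖x - y‖ ^ 2 ≤ 1 / 4 := by nlinarith [norm_nonneg (x - y)]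
      apply abs_le_of_sq_le_sq' _ (by norm_num) |>.2
      rw [mul_pow]
      nlinarith [sq_nonneg ‖x - y‖]
    have h3 : |inner ℝ (A (x - y)) (x + y)| ≤ ‖A‖ * (31 / 32) :=
      calc |inner ℝ (A (x - y)) (x + y)| ≤ ‖A (x - y)‖ * ‖x + y‖ := abs_real_inner_le_norm _ _
        _ ≤ ‖A‖ * ‖x - y‖ * ‖x + y‖ := by gcongr; exact A.le_opNorm _
        _ = ‖A‖ * (‖x - y‖ * ‖x + y‖) := by ring
        _ ≤ _ := by gcongr
    have h4 := hρ y hy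
    have : inner ℝ (A x) x = inner ℝ (A y) y + inner ℝ (A (x - y)) (x + y) := by linarith
    rw [this]
    exact (abs_add_le _ _).trans (add_le_add h4 h3)
  have hρ0 : 0 ≤ ρ := by
    obtain ⟨y, hy, -⟩ := hN 0 (by simp)
    exact (abs_nonneg _).trans (hρ y hy)
  have : ‖A‖ ≤ ρ + ‖A‖ * (31 / 32) := by
    rw [A.norm_eq_iSup_rayleighQuotient hA]
    refine ciSup_le fun x => ?_
    rw [← A.norm_eq_iSup_rayleighQuotient hA]
    rcases eq_or_ne x 0 with rfl | hx
    · simp; positivity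
    · have hx0 : ‖x‖ ≠ 0 := norm_ne_zero_iff.2 hx
      rw [← A.rayleigh_smul x (c := ‖x‖⁻¹) (by simpa using hx0)]
      have hn : ‖(‖x‖⁻¹ • x)‖ = 1 := by rw [norm_smul]; simp [hx0]
      simpa [ContinuousLinearMap.rayleighQuotient, ContinuousLinearMap.reApplyInnerSelf_apply, hn]
        using key _ hn
  linarith

lemma toLp_mulVec_eq_sum_dictColumn {M K : ℕ} (D : Matrix (Fin M) (Fin K) ℝ)
    (x : EuclideanSpace ℝ (Fin K)) :
    (WithLp.toLp 2 (D *ᵥ x.ofLp) : EuclideanSpace ℝ (Fin M)) = ∑ k, x k • dictColumn D k := by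
  ext i
  simp [dictColumn, Matrix.mulVec, dotProduct, mul_comm]

lemma frameDeviation_le_of_net {M K : ℕ} (D : Matrix (Fin M) (Fin K) ℝ)
    {N : Finset (EuclideanSpace ℝ (Fin M))} (hN1 : ∀ y ∈ N, ‖y‖ ≤ 1)
    (hN : ∀ x : EuclideanSpace ℝ (Fin M), ‖x‖ ≤ 1 → ∃ y ∈ N, ‖x - y‖ ≤ 1 / 2) {ρ : ℝ}
    (hρ : ∀ y ∈ N, |∑ k, (inner ℝ y (dictColumn D k) ^ 2 - ‖y‖ ^ 2 / M)| ≤ ρ) :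
    frameDeviation D ≤ 32 * ρ := by
  refine norm_le_of_abs_inner_le_on_net ?_ hN1 hN fun y hy => ?_
  · have h : (D * Dᵀ - ((K : ℝ) / (M : ℝ)) • (1 : Matrix (Fin M) (Fin M) ℝ)).IsHermitian := by
      rw [Matrix.IsHermitian, Matrix.conjTranspose_eq_transpose_of_trivial]
      simp
    exact Matrix.isSymmetric_toEuclideanLin_iff.2 h
  · convert! hρ y hy using 2
    have h1 : (Matrix.toEuclideanCLM (𝕜 := ℝ) (n := Fin M)
        (D * Dᵀ - ((K : ℝ) / (M : ℝ)) • (1 : Matrix (Fin M) (Fin M) ℝ))) y =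
        (∑ k, inner ℝ y (dictColumn D k) • dictColumn D k) - ((K : ℝ) / M) • y := by
      rw [map_sub, map_smul, map_one]
      simp only [sub_apply, smul_apply, one_apply_eq_self]
      congr 1
      have : (Matrix.toEuclideanCLM (𝕜 := ℝ) (n := Fin M) (D * Dᵀ)) y =
          WithLp.toLp 2 (D *ᵥ (WithLp.toLp 2 (Dᵀ *ᵥ y.ofLp) : EuclideanSpace ℝ (Fin K)).ofLp) := by
        ext i
        simp
      rw [this, toLp_mulVec_eq_sum_dictColumn]
      refine Finset.sum_congr rfl fun k _ => ?_
      congr 1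
    rw [h1, inner_sub_left, sum_inner, inner_smul_left, real_inner_self_eq_norm_sq,
      Finset.sum_sub_distrib]
    simp only [inner_smul_left, conj_trivial, Finset.sum_const, Finset.card_univ,
      Fintype.card_fin, nsmul_eq_mul]
    congr 1
    · refine Finset.sum_congr rfl fun k _ => ?_
      rw [real_inner_comm, sq]
    ring

/-- The net bound applied to the symmetric operator `L* L - 1`. -/
lemma abs_norm_sq_sub_le_of_net {V F : Type*} [NormedAddCommGroup V] [InnerProductSpace ℝ V]
    [CompleteSpace V] [NormedAddCommGroup F] [InnerProductSpace ℝ F] [CompleteSpace F]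
    (L : V →L[ℝ] F) {N : Finset V} (hN1 : ∀ y ∈ N, ‖y‖ ≤ 1)
    (hN : ∀ x : V, ‖x‖ ≤ 1 → ∃ y ∈ N, ‖x - y‖ ≤ 1 / 2) {ρ : ℝ}
    (hρ : ∀ y ∈ N, |‖L y‖ ^ 2 - ‖y‖ ^ 2| ≤ ρ) (x : V) :
    |‖L x‖ ^ 2 - ‖x‖ ^ 2| ≤ 32 * ρ * ‖x‖ ^ 2 := by
  set A : V →L[ℝ] V := L.adjoint ∘L L - 1 with hA
  have hAi : ∀ x y, inner ℝ (A x) y = inner ℝ (L x) (L y) - inner ℝ x y := fun x y => by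
    simp [hA, inner_sub_left, ContinuousLinearMap.adjoint_inner_left]
  have hq : ∀ x, inner ℝ (A x) x = ‖L x‖ ^ 2 - ‖x‖ ^ 2 := fun x => by
    rw [hAi, real_inner_self_eq_norm_sq, real_inner_self_eq_norm_sq]
  have hsymm : A.IsSymmetric := fun x y => by
    change inner ℝ (A x) y = inner ℝ x (A y)
    rw [hAi, ← real_inner_comm x (A y), hAi, real_inner_comm (L x), real_inner_comm x]
  have hnorm := norm_le_of_abs_inner_le_on_net hsymm hN1 hN (ρ := ρ) fun y hy => by
    rw [hq]; exact hρ y hy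
  rw [← hq]
  calc |inner ℝ (A x) x| ≤ ‖A x‖ * ‖x‖ := abs_real_inner_le_norm _ _
    _ ≤ ‖A‖ * ‖x‖ * ‖x‖ := by gcongr; exact A.le_opNorm x
    _ ≤ 32 * ρ * ‖x‖ * ‖x‖ := by gcongr
    _ = _ := by ring

/-! ### Sparse vectors, restricted isometry and coherence -/

/-- The nets are fixed before `d`, so that a union bound applies to random columns. Supports are
indexed by maps `f`, repetitions allowed, which covers all sizes up to `n` with `K^n` indices. -/
lemma exists_sparse_net (M K n : ℕ) : ∃ N : (Fin n → Fin K) → Finset (EuclideanSpace ℝ (Fin K)),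
    (∀ f, (N f).card ≤ 5 ^ n) ∧ (∀ f, ∀ y ∈ N f, ‖y‖ ≤ 1) ∧
    ∀ (d : Fin K → EuclideanSpace ℝ (Fin M)) (ρ : ℝ),
      (∀ f, ∀ y ∈ N f, |‖∑ k, y k • d k‖ ^ 2 - ‖y‖ ^ 2| ≤ ρ) →
      ∀ x : EuclideanSpace ℝ (Fin K), {k | x k ≠ 0}.ncard ≤ n →
        |‖∑ k, x k • d k‖ ^ 2 - ‖x‖ ^ 2| ≤ 32 * ρ * ‖x‖ ^ 2 := by
  classical
  let V : (Fin n → Fin K) → Submodule ℝ (EuclideanSpace ℝ (Fin K)) := fun f =>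
    Submodule.span ℝ (Set.range fun i => EuclideanSpace.single (f i) (1 : ℝ))
  choose N hcard hN1 hN using fun f => exists_half_net_unitBall (V f)
  refine ⟨fun f => (N f).map (Function.Embedding.subtype _), fun f => ?_, fun f y hy => ?_,
    fun d ρ h x hx => ?_⟩
  · rw [Finset.card_map]
    refine (hcard f).trans (Nat.pow_le_pow_right (by norm_num) ?_)
    exact (finrank_range_le_card (R := ℝ) fun i => EuclideanSpace.single (f i) (1 : ℝ)).trans_eq
      (Fintype.card_fin n)
  · obtain ⟨z, hz, rfl⟩ := Finset.mem_map.1 hy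
    exact hN1 f z hz
  · rcases eq_or_ne x 0 with rfl | hx0
    · simp
    obtain ⟨k₀, hk₀⟩ : ∃ k, x k ≠ 0 := by
      by_contra! hcon
      exact hx0 (by ext k; simpa using hcon k)
    have : Nonempty {k | x k ≠ 0} := ⟨⟨k₀, hk₀⟩⟩
    obtain ⟨g⟩ : Nonempty ({k | x k ≠ 0} ↪ Fin n) :=
      Function.Embedding.nonempty_of_card_le (by
        rwa [Fintype.card_fin, ← Nat.card_eq_fintype_card])
    let f : Fin n → Fin K := fun i => (Function.invFun g i : {k | x k ≠ 0})
    have hf : ∀ k, x k ≠ 0 → ∃ i, f i = k := fun k hk =>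
      ⟨g ⟨k, hk⟩, by simp only [f, Function.leftInverse_invFun g.injective _]⟩
    have hxV : x ∈ V f := by
      have : x = ∑ k, x k • EuclideanSpace.single k (1 : ℝ) := by
        ext i; simp [Pi.single_apply]
      rw [this]
      refine Submodule.sum_mem _ fun k _ => ?_
      by_cases hk : x k = 0
      · simp [hk]
      · obtain ⟨i, rfl⟩ := hf k hk
        exact Submodule.smul_mem _ _ (Submodule.subset_span ⟨i, rfl⟩)
    let G : EuclideanSpace ℝ (Fin K) →L[ℝ] EuclideanSpace ℝ (Fin M) :=
      ∑ k, (EuclideanSpace.proj k : EuclideanSpace ℝ (Fin K) →L[ℝ] ℝ).smulRight (d k)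
    have hG : ∀ z, G z = ∑ k, z k • d k := fun z => by simp [G]
    have := abs_norm_sq_sub_le_of_net (G ∘L (V f).subtypeL) (hN1 f) (hN f) (ρ := ρ)
      (fun y hy => by
        simpa [hG] using h f y (Finset.mem_map_of_mem (Function.Embedding.subtype _) hy)) ⟨x, hxV⟩
    simpa [hG] using this

/-- For `δ ≥ 0`, a bound on squares passes to norms: `√(1+δ) ≤ 1+δ`, and `√(1-δ) ≥ 1-δ` when `δ ≤
1`. A basis vector shows that admissible constants are nonnegative, so the infimum is over a set
bounded below. -/
lemma restrictedIsometryConstant_le {M K n : ℕ} (D : Matrix (Fin M) (Fin K) ℝ) (hK : 1 ≤ K)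
    (hn : 1 ≤ n) {δ : ℝ} (h : ∀ x : EuclideanSpace ℝ (Fin K), {k | x k ≠ 0}.ncard ≤ n →
      |‖∑ k, x k • dictColumn D k‖ ^ 2 - ‖x‖ ^ 2| ≤ δ * ‖x‖ ^ 2) :
    restrictedIsometryConstant D n ≤ δ := by
  classical
  have hcard : ∀ k : Fin K, {j | (EuclideanSpace.single k (1 : ℝ)) j ≠ 0}.ncard ≤ n := fun k => by
    have : {j | (EuclideanSpace.single k (1 : ℝ)) j ≠ 0} = {k} := by
      ext j; simp
    rw [this, Set.ncard_singleton]; exact hn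
  have hδ : 0 ≤ δ := by
    have := h _ (hcard ⟨0, hK⟩)
    simp only [PiLp.norm_single, norm_one, one_pow, mul_one] at this
    exact (abs_nonneg _).trans this
  refine csInf_le ⟨0, fun δ' h' => ?_⟩ fun x hx => ?_
  · have := h' _ (hcard ⟨0, hK⟩)
    have h2 := this.1.trans this.2
    simp only [PiLp.norm_single, norm_one, mul_one] at h2
    linarith
  · have hb := abs_le.1 (h x hx)
    rw [toLp_mulVec_eq_sum_dictColumn]
    set a := ‖∑ k, x k • dictColumn D k‖
    have ha : 0 ≤ a := norm_nonneg _
    have hx0 := norm_nonneg x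
    constructor
    · by_contra! hlt
      have h1 : 0 < ‖x‖ := by
        by_contra! h0
        have : ‖x‖ = 0 := le_antisymm h0 hx0
        rw [this] at hlt
        linarith
      nlinarith [mul_nonneg hδ hx0, mul_nonneg ha hx0, mul_nonneg hδ (mul_nonneg ha hx0)]
    · refine abs_le_of_sq_le_sq' ?_ (by positivity) |>.2
      nlinarith [mul_nonneg hδ (sq_nonneg ‖x‖), mul_nonneg (sq_nonneg δ) (sq_nonneg ‖x‖)]

/-- Polarization: subtract the bounds at `e_k + e_m` and `e_k - e_m`. -/
lemma abs_inner_dictColumn_le {M K : ℕ} (D : Matrix (Fin M) (Fin K) ℝ) {δ : ℝ}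
    (h : ∀ x : EuclideanSpace ℝ (Fin K), {k | x k ≠ 0}.ncard ≤ 2 →
      |‖∑ k, x k • dictColumn D k‖ ^ 2 - ‖x‖ ^ 2| ≤ δ * ‖x‖ ^ 2) {k m : Fin K} (hkm : k ≠ m) :
    |inner ℝ (dictColumn D k) (dictColumn D m)| ≤ δ := by
  classical
  have key : ∀ c : ℝ, c ^ 2 = 1 → |‖dictColumn D k + c • dictColumn D m‖ ^ 2 - 2| ≤ δ * 2 := by
    intro c hc
    have hs : {j | (EuclideanSpace.single k (1 : ℝ) + EuclideanSpace.single m c) j ≠ 0}.ncard ≤ 2 := by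
      refine (Set.ncard_le_ncard (t := {k, m}) (fun j hj => ?_)).trans (Set.ncard_pair hkm).le
      by_contra hcon
      simp only [Set.mem_insert_iff, Set.mem_singleton_iff, not_or] at hcon
      exact hj (by simp [hcon.1, hcon.2])
    have hn : ‖EuclideanSpace.single k (1 : ℝ) + EuclideanSpace.single m c‖ ^ 2 = 2 := by
      rw [norm_add_sq_real]
      simp [EuclideanSpace.inner_single_left, hkm, hc]
      norm_num
    have := h _ hs
    rw [hn] at this
    simpa [add_smul, Finset.sum_add_distrib, Pi.single_apply] using this
  have h1 := abs_le.1 (key 1 (by norm_num))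
  have h2 := abs_le.1 (key (-1) (by norm_num))
  rw [norm_add_sq_real, norm_smul, inner_smul_right] at h1 h2
  norm_num at h1 h2
  rw [abs_le]
  constructor <;> linarith

/-! ### Union bounds and failure probabilities -/

/-- The leading `2M` pays for the net, as `5 ≤ e²`; the variance term is again `2M`, and the gain is
`(6250/32) M`. Here `6250 = 200000/32`. -/
lemma frame_exponent_le {M K : ℝ} (hM : 0 < M) (hK : 0 < K) :
    2 * M + (K * (2048 * (M * √M / √K / 32) ^ 2 / M ^ 2) - M * √M / √K / 32 * (6250 * √K / √M)) ≤
      -M := by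
  have h1 : √M ^ 2 = M := Real.sq_sqrt hM.le
  have h2 : √K ^ 2 = K := Real.sq_sqrt hK.le
  have h3 : 0 < √M := Real.sqrt_pos.2 hM
  have h4 : 0 < √K := Real.sqrt_pos.2 hK
  have e1 : K * (2048 * (M * √M / √K / 32) ^ 2 / M ^ 2) = 2 * M := by
    rw [div_pow, div_pow, mul_pow, h1, h2]; field_simp; norm_num
  have e2 : M * √M / √K / 32 * (6250 * √K / √M) = 6250 / 32 * M := by field_simp
  rw [e1, e2]
  linarith

lemma measure_frameDeviation_gt_le {Ω : Type*} [MeasurableSpace Ω] {P : Measure Ω}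
    {M K : ℕ} [NeZero M] (hMK : M ≤ K) {D : Ω → Matrix (Fin M) (Fin K) ℝ}
    (hd : ∀ k, Measurable fun ω => dictColumn (D ω) k)
    (hind : iIndepFun (fun k ω => dictColumn (D ω) k) P)
    (hlaw : ∀ k, P.map (fun ω => dictColumn (D ω) k) = uniformUnitSphere M) :
    P {ω | ¬ frameDeviation (D ω) ≤ 200000 * √(K : ℝ) / √(M : ℝ)} ≤
      2 * ENNReal.ofReal (Real.exp (-M)) := by
  have hM : 0 < (M : ℝ) := by exact_mod_cast NeZero.pos M
  have hMK' : (M : ℝ) ≤ K := by exact_mod_cast hMK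
  obtain ⟨N, hcard, hN1, hN⟩ := exists_half_net_unitBall (EuclideanSpace ℝ (Fin M))
  rw [finrank_euclideanSpace_fin] at hcard
  set ρ : ℝ := 6250 * √(K : ℝ) / √(M : ℝ) with hρ
  set t : ℝ := M * √(M : ℝ) / √(K : ℝ) / 32 with ht
  have ht16 : t ≤ M / 16 := by
    have hs : √(M : ℝ) ≤ √(K : ℝ) := Real.sqrt_le_sqrt hMK'
    have : M * √(M : ℝ) / √(K : ℝ) ≤ M := by
      rw [div_le_iff₀ (Real.sqrt_pos.2 (hM.trans_le hMK'))]; gcongr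
    rw [ht]; linarith
  set c : ENNReal := 2 * ENNReal.ofReal (Real.exp (K * (2048 * t ^ 2 / M ^ 2) - t * ρ))
  calc _ ≤ P (⋃ y ∈ N, {ω | ρ ≤ |∑ k, (inner ℝ y (dictColumn (D ω) k) ^ 2 - ‖y‖ ^ 2 / M)|}) := by
        refine measure_mono fun ω hω => ?_
        by_contra hcon
        simp only [Set.mem_iUnion, Set.mem_ofPred_eq, not_exists, not_le] at hcon
        refine hω ((frameDeviation_le_of_net (D ω) hN1 hN fun y hy => (hcon y hy).le).trans_eq ?_)
        rw [hρ]; ring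
    _ ≤ ∑ _y ∈ N, c := (measure_biUnion_finset_le _ _).trans <| Finset.sum_le_sum fun y hy => by
        simpa using measure_le_abs_sum_inner_sq hd hind hlaw (hN1 y hy) (by positivity) ht16 ρ
    _ = N.card * c := by rw [Finset.sum_const, nsmul_eq_mul]
    _ ≤ ENNReal.ofReal (Real.exp (2 * M)) * c := by
        gcongr
        rw [← ENNReal.ofReal_natCast]
        apply ENNReal.ofReal_le_ofReal
        calc (N.card : ℝ) ≤ 5 ^ M := by exact_mod_cast hcard
          _ ≤ Real.exp 2 ^ M := by
            gcongr
            have := Real.quadratic_le_exp_of_nonneg (x := 2) (by norm_num)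
            linarith
          _ = _ := by rw [← Real.exp_nat_mul]; ring_nf
    _ = 2 * ENNReal.ofReal (Real.exp (2 * M + (K * (2048 * t ^ 2 / M ^ 2) - t * ρ))) := by
        rw [Real.exp_add, ENNReal.ofReal_mul (Real.exp_pos _).le]; ring
    _ ≤ _ := by
        gcongr
        exact frame_exponent_le hM (hM.trans_le hMK')

/-- The truncation at 1 keeps `t` in the admissible range `t ≤ M/512`. If `η ≤ 1` the gain is of
order `Mη² = sL²`; otherwise it is of order `Mη = √s √M L`, which dominates `M`, `sL` and `L²`. -/
lemma sparse_exponent_le {M s L : ℝ} (hs : 1 ≤ s) (hsM : s ≤ M) (hL : 1 ≤ L) (hLM : L ≤ √M) :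
    6 * s * L + (64 * (M / 512 * min (√s * L / √M) 1) ^ 2 / M -
      M / 512 * min (√s * L / √M) 1 * (6250 * (√s * L / √M))) ≤ -L ^ 2 := by
  have hM : 0 < M := by linarith
  have h1 : √M ^ 2 = M := Real.sq_sqrt hM.le
  have h2 : √s ^ 2 = s := Real.sq_sqrt (by linarith)
  have h3 : 0 < √M := Real.sqrt_pos.2 hM
  have h4 : 1 ≤ √s := Real.one_le_sqrt.2 hs
  have h5 : √s ≤ √M := Real.sqrt_le_sqrt hsM
  set η := √s * L / √M with hη
  have hη0 : 0 ≤ η := by positivity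
  rcases le_total η 1 with h | h
  · rw [min_eq_left h]
    have e : M * η ^ 2 = s * L ^ 2 := by
      rw [hη, div_pow, mul_pow, h1, h2]; field_simp
    have e2 : 64 * (M / 512 * η) ^ 2 / M - M / 512 * η * (6250 * η) =
      -(49999 / 4096) * (M * η ^ 2) := by field_simp; ring
    rw [e2, e]
    have h6 : s * L ≤ s * L ^ 2 := by
      gcongr
      exact le_self_pow₀ hL two_ne_zero
    have h7 : L ^ 2 ≤ s * L ^ 2 := le_mul_of_one_le_left (sq_nonneg L) hs
    have h8 := sq_nonneg L
    linarith
  · rw [min_eq_right h]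
    have e : M * η = √s * √M * L := by
      rw [hη]; nth_rewrite 1 [← h1]; field_simp
    have e2 : 64 * (M / 512 * 1) ^ 2 / M - M / 512 * 1 * (6250 * η) =
      M / 4096 - 6250 / 512 * (M * η) := by field_simp; ring
    have h6 : M ≤ M * η := le_mul_of_one_le_right hM.le h
    have h7 : s * L ≤ √s * √M * L := by
      nth_rewrite 1 [← h2]
      rw [sq]
      gcongr
    have h8 : L ^ 2 ≤ √s * √M * L := by
      calc L ^ 2 = 1 * L * L := by ring
        _ ≤ √s * √M * L := by gcongr
    rw [e2]
    rw [e] at h6 ⊢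
    linarith

lemma measure_exists_sparse_gt_le {Ω : Type*} [MeasurableSpace Ω] {P : Measure Ω}
    [IsProbabilityMeasure P] {M K s : ℕ} (hs : 1 ≤ s) (hsM : s ≤ M) (hM5 : 5 ≤ M)
    (hKM : K ≤ M ^ 2) (hLM : Real.log M ≤ √(M : ℝ)) {D : Ω → Matrix (Fin M) (Fin K) ℝ}
    (hd : ∀ k, Measurable fun ω => dictColumn (D ω) k)
    (hind : iIndepFun (fun k ω => dictColumn (D ω) k) P)
    (hlaw : ∀ k, P.map (fun ω => dictColumn (D ω) k) = uniformUnitSphere M) :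
    P {ω | ¬ ∀ x : EuclideanSpace ℝ (Fin K), {k | x k ≠ 0}.ncard ≤ 2 * s →
        |‖∑ k, x k • dictColumn (D ω) k‖ ^ 2 - ‖x‖ ^ 2| ≤
          200000 * √(s : ℝ) * Real.log M / √(M : ℝ) * ‖x‖ ^ 2} ≤
      2 * ENNReal.ofReal (Real.exp (-Real.log M ^ 2)) := by
  have : NeZero M := ⟨by omega⟩
  have hM5' : (5 : ℝ) ≤ M := by exact_mod_cast hM5
  have hM : 0 < (M : ℝ) := by linarith
  set L := Real.log M with hLdef
  have hL : 1 ≤ L := by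
    rw [hLdef, Real.le_log_iff_exp_le hM]
    linarith [Real.exp_one_lt_three]
  obtain ⟨N, hcard, hN1, hN⟩ := exists_sparse_net M K (2 * s)
  set η := √(s : ℝ) * L / √(M : ℝ) with hη
  have hη0 : 0 ≤ η := by positivity
  set t : ℝ := M / 512 * min η 1 with ht
  have ht0 : 0 ≤ t := by positivity
  have ht512 : t ≤ M / 512 := mul_le_of_le_one_right (by positivity) (min_le_right _ _)
  set ρ := 6250 * η with hρ
  set c : ENNReal := 2 * ENNReal.ofReal (Real.exp (64 * t ^ 2 / M - t * ρ)) with hc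
  calc _ ≤ P (⋃ f ∈ (Finset.univ : Finset (Fin (2 * s) → Fin K)), ⋃ y ∈ N f,
          {ω | ρ ≤ |‖∑ k, y k • dictColumn (D ω) k‖ ^ 2 - ‖y‖ ^ 2|}) := by
        refine measure_mono fun ω hω => ?_
        by_contra hcon
        simp only [Set.mem_iUnion, Set.mem_ofPred_eq, not_exists, not_le, Finset.mem_univ,
          true_implies] at hcon
        refine hω fun x hx => (hN (fun k => dictColumn (D ω) k) ρ
          (fun f y hy => (hcon f y hy).le) x hx).trans_eq ?_
        rw [hρ, hη]; ring
    _ ≤ ∑ _f : Fin (2 * s) → Fin K, (5 ^ (2 * s) : ℕ) * c := by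
        refine (measure_biUnion_finset_le _ _).trans (Finset.sum_le_sum fun f _ => ?_)
        refine (measure_biUnion_finset_le _ _).trans ?_
        calc _ ≤ ∑ _y ∈ N f, c := Finset.sum_le_sum fun y hy =>
              measure_le_abs_chaos hd hind hlaw (hN1 f y hy) ht0 ht512 ρ
          _ = (N f).card * c := by rw [Finset.sum_const, nsmul_eq_mul]
          _ ≤ _ := by gcongr; exact hcard f
    _ = ((K ^ (2 * s) * 5 ^ (2 * s) : ℕ) : ENNReal) * c := by
        rw [Finset.sum_const, nsmul_eq_mul, Finset.card_univ, Fintype.card_fun, Fintype.card_fin,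
          Fintype.card_fin, ← mul_assoc]
        push_cast
        rfl
    _ ≤ ENNReal.ofReal (Real.exp (6 * s * L)) * c := by
        gcongr
        rw [← ENNReal.ofReal_natCast]
        apply ENNReal.ofReal_le_ofReal
        -- Both `K ≤ M²` and `5 ≤ M` are used to write the count as a power of `M`.
        calc ((K ^ (2 * s) * 5 ^ (2 * s) : ℕ) : ℝ) ≤ (((M ^ 2) ^ (2 * s) * M ^ (2 * s) : ℕ) : ℝ) := by
              gcongr
          _ = (M : ℝ) ^ (6 * s) := by push_cast; ring
          _ = _ := by
              rw [← Real.exp_log hM, ← Real.exp_nat_mul, ← hLdef]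
              simp
    _ = 2 * ENNReal.ofReal (Real.exp (6 * s * L + (64 * t ^ 2 / M - t * ρ))) := by
        rw [Real.exp_add, ENNReal.ofReal_mul (Real.exp_pos _).le, hc]; ring
    _ ≤ _ := by
        gcongr
        exact sparse_exponent_le (by exact_mod_cast hs) (by exact_mod_cast hsM) hL hLM

lemma measure_notMem_dictionaryBounds_le_of_measurable {Ω : Type*} [MeasurableSpace Ω]
    {P : Measure Ω} [IsProbabilityMeasure P] {M K s : ℕ} (hs : 1 ≤ s) (hsM : s ≤ M) (hM5 : 5 ≤ M)
    (hMK : M ≤ K) (hKM : K ≤ M ^ 2) (hLM : Real.log M ≤ √(M : ℝ))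
    {D : Ω → Matrix (Fin M) (Fin K) ℝ}
    (hd : ∀ k, Measurable fun ω => dictColumn (D ω) k)
    (hind : iIndepFun (fun k ω => dictColumn (D ω) k) P)
    (hlaw : ∀ k, P.map (fun ω => dictColumn (D ω) k) = uniformUnitSphere M) :
    P {ω | D ω ∉ dictionaryBounds 200000 200000 M K s} ≤
      2 * ENNReal.ofReal (Real.exp (-M)) + 4 * ENNReal.ofReal (Real.exp (-Real.log M ^ 2)) := by
  have : NeZero M := ⟨by omega⟩
  have h1 := measure_frameDeviation_gt_le hMK hd hind hlaw
  have h2 := measure_exists_sparse_gt_le hs hsM hM5 hKM hLM hd hind hlaw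
  -- The case `s = 1`, for the coherence bound.
  have h3 := measure_exists_sparse_gt_le le_rfl (by omega) hM5 hKM hLM hd hind hlaw
  calc _ ≤ _ := by
        refine measure_mono (t := _ ∪ (_ ∪ _)) fun ω hω => ?_
        by_contra hcon
        simp only [Set.mem_union, not_or] at hcon
        obtain ⟨g1, g2, g3⟩ := hcon
        exact hω ⟨not_not.1 g1, fun k m hkm =>
          (abs_inner_dictColumn_le (D ω) (not_not.1 g3) hkm).trans_eq (by simp),
          restrictedIsometryConstant_le (D ω) (by omega) (by omega) (not_not.1 g2)⟩
    _ ≤ _ := (measure_union_le _ _).trans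
        (add_le_add h1 ((measure_union_le _ _).trans (add_le_add h2 h3)))
    _ = _ := by ring

/-- The columns are only a.e. measurable, so the estimate is transferred to the product of spheres;
the inequality `Measure.le_map_apply` needs no measurability of the bad event. -/
lemma measure_notMem_dictionaryBounds_le {Ω : Type*} [MeasurableSpace Ω]
    {P : Measure Ω} {M K s : ℕ} (hs : 1 ≤ s) (hsM : s ≤ M) (hM5 : 5 ≤ M)
    (hMK : M ≤ K) (hKM : K ≤ M ^ 2) (hLM : Real.log M ≤ √(M : ℝ))
    {D : Ω → Matrix (Fin M) (Fin K) ℝ} (hD : IsUniformDictionary D P) :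
    P {ω | D ω ∉ dictionaryBounds 200000 200000 M K s} ≤
      2 * ENNReal.ofReal (Real.exp (-M)) + 4 * ENNReal.ofReal (Real.exp (-Real.log M ^ 2)) := by
  have : NeZero M := ⟨by omega⟩
  let Q : Measure (Fin K → EuclideanSpace ℝ (Fin M)) := Measure.pi fun _ => uniformUnitSphere M
  let D' : (Fin K → EuclideanSpace ℝ (Fin M)) → Matrix (Fin M) (Fin K) ℝ :=
    fun v => Matrix.of fun i k => v k i
  have hcol : ∀ v k, dictColumn (D' v) k = v k := fun v k => rfl
  have hmap : P.map (fun ω k => dictColumn (D ω) k) = Q := by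
    rw [hD.indep.map_fun_eq_pi_map fun k => (hD.law k).aemeasurable]
    simp_rw [(hD.law _).map_eq]
    rfl
  have hae : AEMeasurable (fun ω k => dictColumn (D ω) k) P :=
    aemeasurable_pi_lambda _ fun k => (hD.law k).aemeasurable
  calc _ = P ((fun ω k => dictColumn (D ω) k) ⁻¹'
        {v | D' v ∉ dictionaryBounds 200000 200000 M K s}) := rfl
    _ ≤ Q {v | D' v ∉ dictionaryBounds 200000 200000 M K s} := by
        rw [← hmap]; exact Measure.le_map_apply hae _
    _ ≤ _ := by
        refine measure_notMem_dictionaryBounds_le_of_measurable hs hsM hM5 hMK hKM hLM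
          (fun k => ?_) ?_ fun k => ?_
        · simp_rw [hcol]; exact measurable_pi_apply k
        · simp_rw [hcol]
          exact iIndepFun_pi (X := fun _ v => v) fun _ => aemeasurable_id
        · simp_rw [hcol]
          exact (measurePreserving_eval (fun _ : Fin K => uniformUnitSphere M) k).map_eq

/-! ### Asymptotics and conclusion -/

lemma le_sq_of_div_rpow_le {M K : ℕ} (hM : 0 < M) (hK : 0 < K)
    (h : (K : ℝ) / (M : ℝ) ^ (3 / 2 : ℝ) ≤ √(K : ℝ) / √(M : ℝ)) : K ≤ M ^ 2 := by
  have hM' : 0 < (M : ℝ) := by exact_mod_cast hM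
  have hK' : 0 < √(K : ℝ) := Real.sqrt_pos.2 (by exact_mod_cast hK)
  have hs : 0 < √(M : ℝ) := Real.sqrt_pos.2 hM'
  have e : (M : ℝ) ^ (3 / 2 : ℝ) = M * √(M : ℝ) := by
    rw [Real.sqrt_eq_rpow, ← Real.rpow_one_add' hM'.le (by norm_num)]
    norm_num
  have e2 : (K : ℝ) = √(K : ℝ) * √(K : ℝ) := (Real.mul_self_sqrt (Nat.cast_nonneg _)).symm
  rw [e, div_le_div_iff₀ (by positivity) hs] at h
  have h1 : √(K : ℝ) ≤ M := by
    have : (√(K : ℝ) * √(M : ℝ)) * √(K : ℝ) ≤ (√(K : ℝ) * √(M : ℝ)) * M := by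
      rw [e2] at h
      rw [Real.sqrt_mul_self hK'.le] at h
      linarith
    exact le_of_mul_le_mul_left this (by positivity)
  have : (K : ℝ) ≤ (M : ℝ) ^ 2 := (Real.sqrt_le_left hM'.le).1 h1
  exact_mod_cast this

lemma tendsto_rpow_mul_exp_neg_log_sq (a : ℝ) :
    Tendsto (fun M : ℕ => (M : ℝ) ^ a * Real.exp (-Real.log M ^ 2)) atTop (𝓝 0) := by
  have h1 : Tendsto (fun x : ℝ => Real.exp (x * (a - x))) atTop (𝓝 0) := by
    refine Real.tendsto_exp_atBot.comp (Tendsto.atTop_mul_atBot₀ tendsto_id ?_)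
    exact tendsto_atBot_add_const_left _ _ tendsto_neg_atTop_atBot
  refine (h1.comp (Real.tendsto_log_atTop.comp tendsto_natCast_atTop_atTop)).congr' ?_
  filter_upwards [eventually_gt_atTop 0] with M hM
  have hM' : 0 < (M : ℝ) := by exact_mod_cast hM
  simp only [Function.comp_apply]
  rw [Real.rpow_def_of_pos hM', ← Real.exp_add]
  congr 1; ring

theorem lemma1 :
    ∃ B : ℝ, 0 < B ∧ ∃ C : ℝ, 0 < C ∧
      ∀ (K s : ℕ → ℕ),
        (∀ᶠ M : ℕ in atTop, 1 ≤ s M ∧ s M < M ∧ M < K M ∧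
          (K M : ℝ) / (M : ℝ) ^ (3 / 2 : ℝ) ≤ √(K M : ℝ) / √(M : ℝ)) →
      ∀ (Ω : ℕ → Type*) [∀ M, MeasurableSpace (Ω M)]
        (P : ∀ M, Measure (Ω M)) [∀ M, IsProbabilityMeasure (P M)]
        (D : ∀ M, Ω M → Matrix (Fin M) (Fin (K M)) ℝ),
        (∀ᶠ M : ℕ in atTop, IsUniformDictionary (D M) (P M)) →
        (∀ a : ℝ, 0 < a → Tendsto
          (fun M : ℕ => (M : ℝ) ^ a *
            (P M).real {ω | D M ω ∉ dictionaryBounds B C M (K M) (s M)}) atTop (𝓝 0)) ∧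
        ((∀ᶠ M : ℕ in atTop, B * √(s M : ℝ) * Real.log M / √(M : ℝ) < 1 / 8) →
          ∀ a : ℝ, 0 < a → Tendsto
            (fun M : ℕ => (M : ℝ) ^ a *
              (P M).real {ω | D M ω ∉ goodDictionaries B C M (K M) (s M)}) atTop (𝓝 0)) := by
  refine ⟨200000, by norm_num, 200000, by norm_num, ?_⟩
  intro K s hKs Ω _ P _ D hD
  have hlog : ∀ᶠ M : ℕ in atTop, Real.log M ≤ √(M : ℝ) := by
    have h := (isLittleO_log_rpow_atTop (r := 1 / 2) (by norm_num)).bound one_pos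
    filter_upwards [tendsto_natCast_atTop_atTop.eventually h] with M hM
    rw [← Real.sqrt_eq_rpow, one_mul, Real.norm_of_nonneg (Real.sqrt_nonneg _)] at hM
    exact (le_abs_self _).trans hM
  have key : ∀ a : ℝ, 0 < a → Tendsto (fun M : ℕ => (M : ℝ) ^ a *
      (P M).real {ω | D M ω ∉ dictionaryBounds 200000 200000 M (K M) (s M)}) atTop (𝓝 0) := by
    intro a _
    refine squeeze_zero' (Eventually.of_forall fun M => by positivity) ?_
      (by simpa using (tendsto_rpow_mul_exp_neg_log_sq a).const_mul 6)
    filter_upwards [hKs, hD, hlog, eventually_ge_atTop 5] with M ⟨h1, h2, h3, h4⟩ hDM hl hM5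
    have hb := measure_notMem_dictionaryBounds_le h1 h2.le hM5 h3.le
      (le_sq_of_div_rpow_le (by omega) (by omega) h4) hl hDM
    have hl0 : 0 ≤ Real.log M := Real.log_natCast_nonneg M
    -- Since `log M ≤ √M`, the frame failure is absorbed in the other term, giving `6 = 2 + 4`.
    have hexp : Real.exp (-M) ≤ Real.exp (-Real.log M ^ 2) := by
      apply Real.exp_le_exp.2
      have : Real.log M ^ 2 ≤ √(M : ℝ) ^ 2 := by gcongr
      rw [Real.sq_sqrt (Nat.cast_nonneg _)] at this
      linarith
    have hb' : (P M).real {ω | D M ω ∉ dictionaryBounds 200000 200000 M (K M) (s M)} ≤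
        6 * Real.exp (-Real.log M ^ 2) := by
      refine ENNReal.toReal_le_of_le_ofReal (by positivity) (hb.trans ?_)
      rw [ENNReal.ofReal_mul (by norm_num), ENNReal.ofReal_ofNat]
      calc _ ≤ 2 * ENNReal.ofReal (Real.exp (-Real.log M ^ 2)) +
            4 * ENNReal.ofReal (Real.exp (-Real.log M ^ 2)) := by gcongr
        _ = _ := by rw [← add_mul]; norm_num
    calc _ ≤ (M : ℝ) ^ a * (6 * Real.exp (-Real.log M ^ 2)) := by gcongr
      _ = _ := by ring
  refine ⟨key, fun hsmall a ha => (key a ha).congr' ?_⟩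
  filter_upwards [hsmall] with M hM
  simp only [goodDictionaries, Set.mem_ofPred_eq, hM, and_true]
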